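/- Theorem (Vanishing of $\delta$-cohomology in low dimensions). Let $G$ be a group and $M$ a $G$-module. Then $$H^i_\delta(G,M)=0\quad\text{for } 0\le i\le 4,$$ and the natural map $\gamma^i\colon H^i_\lambda(G,M)\to HS^i(G,M)$ is an isomorphism for $i=0,1,2,3,4$. Here the notation is as follows. For an abelian group $A$, let $\Lambda^*(A)$ be the exterior algebra (the tensor algebra modulo the two-sided ideal generated by all $a\otimes a$), let $\tilde\Lambda^*(A)$ be the tensor algebra modulo the two-sided ideal generated by all $a\otimes b+b\otimes a$, and let $\Delta^n(A)=\ker(\tilde\Lambda^n(A)\to\Lambda^n(A))$. For $A=\mathbb Z[G]$, the group $G$ acts diagonally on $\Lambda^n$, $\tilde\Lambda^n$ and $\Delta^n$. The differential is given on products of $g_0,\dots,g_n\in G$ by $\partial(g_0\cdots g_n)=\sum_{i=0}^n(-1)^i g_0\cdots\hat g_i\cdots g_n$; on $\Delta^*$ it is the restriction of the differential of $\tilde\Lambda^*$. For $n\ge 0$, $$H^n_\lambda(G,M)=H^n\big(\mathrm{Hom}_G(\Lambda^{*+1}(\mathbb Z[G]),M)\big),\qquad H^n_\delta(G,M)=H^n\big(\mathrm{Hom}_G(\Delta^{*+1}(\mathbb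 Z[G]),M)\big).$$ The symmetric cohomology $HS^n(G,M)$ is the cohomology of the subcomplex $CS^*(G,M)$ of the complex $C^*(G,M)$ of inhomogeneous cochains $\phi\colon G^n\to M$ (with its usual differential), where $CS^n(G,M)$ consists of the cochains fixed by the operators $\tau_1,\dots,\tau_n$, $$(\tau_1\phi)(g_1,\dots,g_n)=-g_1\,\phi(g_1^{-1},g_1g_2,g_3,\dots,g_n),$$ $$(\tau_i\phi)(g_1,\dots,g_n)=-\phi(g_1,\dots,g_{i-2},g_{i-1}g_i,g_i^{-1},g_ig_{i+1},g_{i+2},\dots,g_n)\quad(1<i\le n),$$ the entry $g_ig_{i+1}$ (for $i=1$: $g_1g_2$) being absent when $i=n$; these operators define an action of the symmetric group $\Sigma_{n+1}$ on $C^n(G,M)$. The map $\gamma^n$ is induced by the morphism of complexes that sends $f\in\mathrm{Hom}_G(\Lambda^{n+1}(\mathbb Z[G]),M)$ to the cochain $(g_1,\dots,g_n)\mapsto f(1\wedge g_1\wedge g_1g_2\wedge\cdots\wedge g_1g_2\cdots g_n)$. -/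

import Mathlib

noncomputable section

namespace SymmetricCohomology

open CategoryTheory
open scoped MonoidAlgebra

universe w u v

/-! ### The two exterior algebras of a module over a commutative ring -/

section ExteriorAlgebras

/-- The two-sided ideal of the tensor algebra `T(A)` generated by the elements
`a ⊗ b + b ⊗ a`, for `a b : A`. -/
def skewIdeal (k : Type w) [CommRing k] (A : Type u) [AddCommGroup A] [Module k A] : TwoSidedIdeal (TensorAlgebra k A) :=
  TwoSidedIdeal.span {x | ∃ a b : A, x =
    TensorAlgebra.ι k a * TensorAlgebra.ι k b + TensorAlgebra.ι k b * TensorAlgebra.ι k a}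

/-- The weak exterior algebra `Λ̃(A)`, the quotient of the tensor algebra of the `k`-module `A`
by the two-sided ideal generated by the elements `a ⊗ b + b ⊗ a`. -/
abbrev WeakExteriorAlgebra (k : Type w) [CommRing k] (A : Type u) [AddCommGroup A] [Module k A] :
    Type (max w u) :=
  TensorAlgebra k A ⧸ (skewIdeal k A).asIdeal

namespace WeakExteriorAlgebra

variable {k : Type w} [CommRing k] {A : Type u} [AddCommGroup A] [Module k A]

variable (k) in
/-- The canonical map `A → Λ̃(A)`. -/
def ι : A →ₗ[k] WeakExteriorAlgebra k A :=
  (Ideal.Quotient.mkₐ k (skewIdeal k A).asIdeal).toLinearMap ∘ₗ TensorAlgebra.ι k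

theorem ι_skew (a b : A) : ι k a * ι k b + ι k b * ι k a = 0 := by
  have h : TensorAlgebra.ι k a * TensorAlgebra.ι k b + TensorAlgebra.ι k b * TensorAlgebra.ι k a ∈
      (skewIdeal k A).asIdeal :=
    TwoSidedIdeal.mem_asIdeal.2 (TwoSidedIdeal.subset_span ⟨a, b, rfl⟩)
  have h2 := Ideal.Quotient.eq_zero_iff_mem.2 h
  simpa [ι] using h2

/-- The universal property of `Λ̃(A)`. -/
def lift {B : Type*} [Ring B] [Algebra k B] (f : A →ₗ[k] B) (hf : ∀ a b, f a * f b + f b * f a = 0) :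
    WeakExteriorAlgebra k A →ₐ[k] B :=
  Ideal.Quotient.liftₐ (skewIdeal k A).asIdeal (TensorAlgebra.lift k f) (by
    intro x hx
    have hle : skewIdeal k A ≤ TwoSidedIdeal.ker (TensorAlgebra.lift k f) := by
      refine TwoSidedIdeal.span_le.2 ?_
      rintro _ ⟨a, b, rfl⟩
      simp [TwoSidedIdeal.mem_ker, hf]
    exact (TwoSidedIdeal.mem_ker _).1 (hle (TwoSidedIdeal.mem_asIdeal.1 hx)))

@[simp] theorem lift_ι {B : Type*} [Ring B] [Algebra k B] (f : A →ₗ[k] B)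
    (hf : ∀ a b, f a * f b + f b * f a = 0) (a : A) : lift f hf (ι k a) = f a :=
  TensorAlgebra.lift_ι_apply f a

/-- Functoriality of `Λ̃`. -/
def map {B : Type*} [AddCommGroup B] [Module k B] (f : A →ₗ[k] B) :
    WeakExteriorAlgebra k A →ₐ[k] WeakExteriorAlgebra k B :=
  lift (ι k ∘ₗ f) fun a b => ι_skew (f a) (f b)

@[simp] theorem map_ι {B : Type*} [AddCommGroup B] [Module k B] (f : A →ₗ[k] B) (a : A) :
    map f (ι k a) = ι k (f a) :=
  lift_ι _ _ a

/-- The canonical projection `Λ̃(A) → Λ(A)`. -/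
def toExterior : WeakExteriorAlgebra k A →ₐ[k] ExteriorAlgebra k A :=
  lift (ExteriorAlgebra.ι k) fun a b => ExteriorAlgebra.ι_add_mul_swap a b

@[simp] theorem toExterior_ι (a : A) : toExterior (ι k a) = ExteriorAlgebra.ι k a :=
  lift_ι _ _ a

/-- The algebra map `Λ̃(A) → M₂(Λ̃(A))` whose diagonal entries are the grade involution and the
identity. Its upper right entry is an antiderivation. -/
def boundaryAux (ε : A →ₗ[k] k) :
    WeakExteriorAlgebra k A →ₐ[k] Matrix (Fin 2) (Fin 2) (WeakExteriorAlgebra k A) :=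
  lift
    { toFun := fun a => !![-ι k a, ε a • 1; 0, ι k a]
      map_add' := fun a b => by
        ext i j; fin_cases i <;> fin_cases j <;> simp [add_smul, add_comm]
      map_smul' := fun r a => by
        ext i j; fin_cases i <;> fin_cases j <;> simp [mul_smul] }
    (fun a b => by
      have h := ι_skew (k := k) a b
      ext i j
      fin_cases i <;> fin_cases j <;> simp [h])

/-- The antiderivation `∂` of `Λ̃(A)` attached to a linear form `ε` on `A`:
it satisfies `∂ (a₀ ∧̃ ⋯ ∧̃ aₙ) = ∑ (-1)ⁱ ε(aᵢ) a₀ ∧̃ ⋯ âᵢ ⋯ ∧̃ aₙ`, see `boundary_prod` below. -/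
def boundary (ε : A →ₗ[k] k) : WeakExteriorAlgebra k A →ₗ[k] WeakExteriorAlgebra k A where
  toFun x := boundaryAux ε x 0 1
  map_add' x y := by simp
  map_smul' r x := by rw [map_smul, Matrix.smul_apply, RingHom.id_apply]

theorem boundaryAux_ι (ε : A →ₗ[k] k) (a : A) :
    boundaryAux ε (ι k a) = !![-ι k a, ε a • 1; 0, ι k a] :=
  lift_ι _ _ a

theorem boundary_one (ε : A →ₗ[k] k) : boundary ε 1 = 0 := by
  simp [boundary]

theorem hom_ext {B : Type*} [Ring B] [Algebra k B] {f g : WeakExteriorAlgebra k A →ₐ[k] B}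
    (h : ∀ a, f (ι k a) = g (ι k a)) : f = g := by
  apply Ideal.Quotient.algHom_ext
  apply TensorAlgebra.hom_ext
  ext a
  exact h a

theorem boundaryAux_apply_one_one (ε : A →ₗ[k] k) (x : WeakExteriorAlgebra k A) :
    boundaryAux ε x 1 1 = x := by
  obtain ⟨x, rfl⟩ := Ideal.Quotient.mk_surjective x
  have key : ∀ y : TensorAlgebra k A,
      boundaryAux ε (Ideal.Quotient.mk _ y) 1 1 = Ideal.Quotient.mk _ y ∧
      boundaryAux ε (Ideal.Quotient.mk _ y) 1 0 = 0 := by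
    intro y
    induction y using TensorAlgebra.induction with
    | algebraMap r =>
      have h : (Ideal.Quotient.mk (skewIdeal k A).asIdeal) (algebraMap k _ r) =
          algebraMap k _ r := rfl
      rw [h, AlgHom.commutes, Matrix.algebraMap_matrix_apply, Matrix.algebraMap_matrix_apply]
      simp
    | ι a =>
      have h : (Ideal.Quotient.mk (skewIdeal k A).asIdeal) (TensorAlgebra.ι k a) = ι k a := rfl
      rw [h, boundaryAux_ι]
      simp
    | mul a b ha hb => simp [Matrix.mul_apply, Fin.sum_univ_two, ha, hb]
    | add a b ha hb => simp [ha, hb]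
  exact (key x).1

theorem boundary_ι_mul (ε : A →ₗ[k] k) (a : A) (x : WeakExteriorAlgebra k A) :
    boundary ε (ι k a * x) = ε a • x - ι k a * boundary ε x := by
  have h := boundaryAux_apply_one_one ε x
  change boundaryAux ε (ι k a * x) 0 1 = ε a • x - ι k a * boundaryAux ε x 0 1
  rw [map_mul, boundaryAux_ι, Matrix.mul_apply, Fin.sum_univ_two, h]
  simp
  abel

end WeakExteriorAlgebra

/-- The `n`-th weak exterior power `Λ̃ⁿ(A)`: the degree `n` part of `Λ̃(A)`, that is, the image of
the `n`-th tensor power of `A`. -/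
abbrev weakExteriorPower (k : Type w) [CommRing k] (n : ℕ) (A : Type u) [AddCommGroup A]
    [Module k A] :
    Submodule k (WeakExteriorAlgebra k A) :=
  LinearMap.range (WeakExteriorAlgebra.ι k (A := A)) ^ n

end ExteriorAlgebras

/-! ### Antiderivations on algebras generated by a module -/

section Antiderivation

variable {k A R A' R' : Type*} [CommRing k] [AddCommGroup A] [Module k A] [Ring R] [Algebra k R]
  [AddCommGroup A'] [Module k A'] [Ring R'] [Algebra k R']

theorem antider_mem (u : A →ₗ[k] R) (ε : A →ₗ[k] k) (D : R →ₗ[k] R)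
    (h1 : D 1 = 0) (h : ∀ a x, D (u a * x) = ε a • x - u a * D x) (n : ℕ) {x : R}
    (hx : x ∈ LinearMap.range u ^ (n + 1)) : D x ∈ LinearMap.range u ^ n := by
  induction n generalizing x with
  | zero =>
    rw [zero_add, pow_one] at hx
    obtain ⟨a, rfl⟩ := hx
    have := h a 1
    rw [mul_one, h1, mul_zero, sub_zero] at this
    rw [this, pow_zero]
    exact Submodule.smul_mem _ _ (Submodule.one_le.1 le_rfl)
  | succ n ih =>
    rw [pow_succ'] at hx
    induction hx using Submodule.mul_induction_on' with
    | mem_mul_mem a ha y hy =>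
      obtain ⟨a, rfl⟩ := ha
      rw [h]
      refine Submodule.sub_mem _ (Submodule.smul_mem _ _ hy) ?_
      rw [pow_succ']
      exact Submodule.mul_mem_mul ⟨a, rfl⟩ (ih hy)
    | add x _ y _ hx hy => rw [map_add]; exact Submodule.add_mem _ hx hy

theorem antider_sq (u : A →ₗ[k] R) (ε : A →ₗ[k] k) (D : R →ₗ[k] R)
    (h1 : D 1 = 0) (h : ∀ a x, D (u a * x) = ε a • x - u a * D x) (n : ℕ) {x : R}
    (hx : x ∈ LinearMap.range u ^ n) : D (D x) = 0 := by
  induction n generalizing x with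
  | zero =>
    rw [pow_zero] at hx
    obtain ⟨r, rfl⟩ := Submodule.mem_one.1 hx
    rw [Algebra.algebraMap_eq_smul_one, map_smul, h1, smul_zero, map_zero]
  | succ n ih =>
    rw [pow_succ'] at hx
    induction hx using Submodule.mul_induction_on' with
    | mem_mul_mem a ha y hy =>
      obtain ⟨a, rfl⟩ := ha
      rw [h, map_sub, h, map_smul, ih hy, mul_zero, sub_zero, sub_self]
    | add x _ y _ hx hy => rw [map_add, map_add, hx, hy, add_zero]

theorem antider_comm (u : A →ₗ[k] R) (ε : A →ₗ[k] k) (D : R →ₗ[k] R)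
    (h1 : D 1 = 0) (h : ∀ a x, D (u a * x) = ε a • x - u a * D x)
    (u' : A' →ₗ[k] R') (ε' : A' →ₗ[k] k) (D' : R' →ₗ[k] R')
    (h1' : D' 1 = 0) (h' : ∀ a x, D' (u' a * x) = ε' a • x - u' a * D' x)
    (T : R →ₐ[k] R') (t : A →ₗ[k] A') (hT : ∀ a, T (u a) = u' (t a))
    (hε : ∀ a, ε' (t a) = ε a) (n : ℕ) {x : R}
    (hx : x ∈ LinearMap.range u ^ n) : D' (T x) = T (D x) := by
  induction n generalizing x with
  | zero =>
    rw [pow_zero] at hx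
    obtain ⟨r, rfl⟩ := Submodule.mem_one.1 hx
    rw [Algebra.algebraMap_eq_smul_one, map_smul, map_smul, map_smul, h1, map_one, h1', smul_zero,
      smul_zero, map_zero]
  | succ n ih =>
    rw [pow_succ'] at hx
    induction hx using Submodule.mul_induction_on' with
    | mem_mul_mem a ha y hy =>
      obtain ⟨a, rfl⟩ := ha
      rw [h, map_mul, hT, h', ih hy, map_sub, map_smul, map_mul, hT, hε]
    | add x _ y _ hx hy => rw [map_add, map_add, hx, hy, map_add, map_add]

theorem antider_prod (u : A →ₗ[k] R) (ε : A →ₗ[k] k) (D : R →ₗ[k] R)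
    (h1 : D 1 = 0) (h : ∀ a x, D (u a * x) = ε a • x - u a * D x) (n : ℕ) (v : Fin (n + 1) → A) :
    D (List.ofFn fun i => u (v i)).prod =
      ∑ i : Fin (n + 1), ((-1 : k) ^ (i : ℕ) * ε (v i)) •
        (List.ofFn fun j => u (v (i.succAbove j))).prod := by
  induction n with
  | zero =>
    have := h (v 0) 1
    rw [mul_one, h1, mul_zero, sub_zero] at this
    simp [this]
  | succ n ih =>
    rw [List.ofFn_succ, List.prod_cons, h, ih (fun i => v i.succ),
      Fin.sum_univ_succ (n := n + 1), sub_eq_add_neg, Finset.mul_sum, ← Finset.sum_neg_distrib]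
    congr 1
    · simp
    · refine Finset.sum_congr rfl fun i _ => ?_
      rw [List.ofFn_succ, List.prod_cons, mul_smul_comm, ← neg_smul]
      simp [pow_succ]

/-- An algebra map sending generators to generators preserves degrees. -/
theorem map_mem_pow (u : A →ₗ[k] R) (u' : A' →ₗ[k] R') (T : R →ₐ[k] R') (t : A →ₗ[k] A')
    (hT : ∀ a, T (u a) = u' (t a)) (n : ℕ) {x : R}
    (hx : x ∈ LinearMap.range u ^ n) : T x ∈ LinearMap.range u' ^ n := by
  have h2 : Submodule.map T.toLinearMap (LinearMap.range u) ≤ LinearMap.range u' := by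
    rintro _ ⟨_, ⟨a, rfl⟩, rfl⟩
    exact ⟨t a, (hT a).symm⟩
  have h3 := Submodule.mem_map_of_mem (f := T.toLinearMap) hx
  rw [Submodule.map_pow] at h3
  exact pow_le_pow_left' h2 n h3

end Antiderivation

theorem WeakExteriorAlgebra.boundary_prod {k : Type w} [CommRing k] {A : Type u} [AddCommGroup A]
    [Module k A] (ε : A →ₗ[k] k) (n : ℕ)
    (v : Fin (n + 1) → A) :
    boundary ε (List.ofFn fun i => ι k (v i)).prod =
      ∑ i : Fin (n + 1), ((-1 : k) ^ (i : ℕ) * ε (v i)) •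
        (List.ofFn fun j => ι k (v (i.succAbove j))).prod :=
  antider_prod (ι k) ε (boundary ε) (boundary_one ε) (boundary_ι_mul ε) n v

/-- The antiderivation `∂` of `Λ(A)` attached to a linear form `ε` on `A` (contraction with `ε`). -/
def exteriorBoundary {k : Type w} [CommRing k] {A : Type u} [AddCommGroup A]
    [Module k A] (ε : A →ₗ[k] k) :
    ExteriorAlgebra k A →ₗ[k] ExteriorAlgebra k A :=
  CliffordAlgebra.contractLeft ε

theorem exteriorBoundary_one {k : Type w} [CommRing k] {A : Type u} [AddCommGroup A]
    [Module k A] (ε : A →ₗ[k] k) :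
    exteriorBoundary ε 1 = 0 :=
  CliffordAlgebra.contractLeft_one 0 ε

theorem exteriorBoundary_ι_mul {k : Type w} [CommRing k] {A : Type u} [AddCommGroup A]
    [Module k A] (ε : A →ₗ[k] k) (a : A)
    (x : ExteriorAlgebra k A) :
    exteriorBoundary ε (ExteriorAlgebra.ι k a * x) =
      ε a • x - ExteriorAlgebra.ι k a * exteriorBoundary ε x :=
  CliffordAlgebra.contractLeft_ι_mul ε a x

/-! ### The complexes `Λ̃^{*+1}(ℤ[G])`, `Λ^{*+1}(ℤ[G])` and `Δ^{*+1}(ℤ[G])` of `G`-modules -/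

section Chains

variable (G : Type u) [Group G]

/-- The augmentation `ℤ[G] → ℤ`, with `g ↦ 1` for `g : G`. -/
def augmentation : ℤ[G] →ₗ[ℤ] ℤ :=
  Finsupp.linearCombination ℤ (fun _ : G => (1 : ℤ)) ∘ₗ
    (MonoidAlgebra.coeffLinearEquiv (M := G) ℤ).toLinearMap

theorem augmentation_of (g : G) : augmentation G (MonoidAlgebra.of ℤ G g) = 1 := by
  simp [augmentation]

theorem leftRegular_of (g h : G) :
    Representation.leftRegular ℤ G g (MonoidAlgebra.of ℤ G h) = MonoidAlgebra.of ℤ G (g * h) := by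
  simp

theorem augmentation_leftRegular (g : G) (a : ℤ[G]) :
    augmentation G (Representation.leftRegular ℤ G g a) = augmentation G a := by
  have h : augmentation G ∘ₗ Representation.leftRegular ℤ G g = augmentation G := by
    ext h
    simp [augmentation]
  exact LinearMap.congr_fun h a

/-- The diagonal action of `G` on `Λ̃ⁿ(ℤ[G])`: `g (x₁ ∧̃ ⋯ ∧̃ xₙ) = g x₁ ∧̃ ⋯ ∧̃ g xₙ`. -/
def weakPowerRep (n : ℕ) : Representation ℤ G (weakExteriorPower ℤ n ℤ[G]) where
  toFun g := (WeakExteriorAlgebra.map (Representation.leftRegular ℤ G g)).toLinearMap.restrict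
    fun _ hx => map_mem_pow _ _ _ (Representation.leftRegular ℤ G g)
      (WeakExteriorAlgebra.map_ι _) n hx
  map_one' := by
    have h : WeakExteriorAlgebra.map (Representation.leftRegular ℤ G (1 : G)) = AlgHom.id ℤ _ :=
      WeakExteriorAlgebra.hom_ext fun a => by
        rw [WeakExteriorAlgebra.map_ι, map_one]; rfl
    ext x
    exact AlgHom.congr_fun h x.1
  map_mul' g g' := by
    have h : WeakExteriorAlgebra.map (Representation.leftRegular ℤ G (g * g')) =
        (WeakExteriorAlgebra.map (Representation.leftRegular ℤ G g)).comp
          (WeakExteriorAlgebra.map (Representation.leftRegular ℤ G g')) :=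
      WeakExteriorAlgebra.hom_ext fun a => by
        rw [WeakExteriorAlgebra.map_ι, AlgHom.comp_apply, WeakExteriorAlgebra.map_ι,
          WeakExteriorAlgebra.map_ι, map_mul]; rfl
    ext x
    exact AlgHom.congr_fun h x.1

/-- The diagonal action of `G` on `Λⁿ(ℤ[G])`: `g (x₁ ∧ ⋯ ∧ xₙ) = g x₁ ∧ ⋯ ∧ g xₙ`. -/
def powerRep (n : ℕ) : Representation ℤ G (⋀[ℤ]^n ℤ[G]) where
  toFun g := (ExteriorAlgebra.map (Representation.leftRegular ℤ G g)).toLinearMap.restrict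
    fun _ hx => map_mem_pow _ _ _ (Representation.leftRegular ℤ G g)
      (ExteriorAlgebra.map_apply_ι _) n hx
  map_one' := by
    have h : ExteriorAlgebra.map (Representation.leftRegular ℤ G (1 : G)) = AlgHom.id ℤ _ := by
      rw [map_one]; exact ExteriorAlgebra.map_id
    refine LinearMap.ext fun x => Subtype.ext ?_
    exact AlgHom.congr_fun h x.1
  map_mul' g g' := by
    have h : ExteriorAlgebra.map (Representation.leftRegular ℤ G (g * g')) =
        (ExteriorAlgebra.map (Representation.leftRegular ℤ G g)).comp
          (ExteriorAlgebra.map (Representation.leftRegular ℤ G g')) := by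
      rw [map_mul, ExteriorAlgebra.map_comp_map]; rfl
    refine LinearMap.ext fun x => Subtype.ext ?_
    exact AlgHom.congr_fun h x.1

/-- The differential `∂ : Λ̃ⁿ⁺¹(ℤ[G]) → Λ̃ⁿ(ℤ[G])`, with
`∂ (g₀ ∧̃ ⋯ ∧̃ gₙ) = ∑ (-1)ⁱ g₀ ∧̃ ⋯ ĝᵢ ⋯ ∧̃ gₙ` for `g₀, …, gₙ : G`. -/
def weakDifferential (n : ℕ) :
    (weakPowerRep G (n + 1)).IntertwiningMap (weakPowerRep G n) where
  toLinearMap := (WeakExteriorAlgebra.boundary (augmentation G)).restrict fun _ hx =>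
    antider_mem _ _ _ (WeakExteriorAlgebra.boundary_one _) (WeakExteriorAlgebra.boundary_ι_mul _) n
      hx
  isIntertwining' g := by
    ext x
    exact antider_comm _ _ _ (WeakExteriorAlgebra.boundary_one (augmentation G))
      (WeakExteriorAlgebra.boundary_ι_mul (augmentation G)) _ _ _
      (WeakExteriorAlgebra.boundary_one (augmentation G))
      (WeakExteriorAlgebra.boundary_ι_mul (augmentation G))
      (WeakExteriorAlgebra.map (Representation.leftRegular ℤ G g))
      (Representation.leftRegular ℤ G g) (WeakExteriorAlgebra.map_ι _)
      (augmentation_leftRegular G g) (n + 1) x.2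

/-- The differential `∂ : Λⁿ⁺¹(ℤ[G]) → Λⁿ(ℤ[G])`, with
`∂ (g₀ ∧ ⋯ ∧ gₙ) = ∑ (-1)ⁱ g₀ ∧ ⋯ ĝᵢ ⋯ ∧ gₙ` for `g₀, …, gₙ : G`. -/
def differential (n : ℕ) : (powerRep G (n + 1)).IntertwiningMap (powerRep G n) where
  toLinearMap := (exteriorBoundary (augmentation G)).restrict fun _ hx =>
    antider_mem _ _ _ (exteriorBoundary_one _) (exteriorBoundary_ι_mul _) n hx
  isIntertwining' g := by
    refine LinearMap.ext fun x => Subtype.ext ?_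
    exact antider_comm _ _ _ (exteriorBoundary_one (augmentation G))
      (exteriorBoundary_ι_mul (augmentation G)) _ _ _ (exteriorBoundary_one (augmentation G))
      (exteriorBoundary_ι_mul (augmentation G))
      (ExteriorAlgebra.map (Representation.leftRegular ℤ G g)) (Representation.leftRegular ℤ G g)
      (ExteriorAlgebra.map_apply_ι _) (augmentation_leftRegular G g) (n + 1) x.2

theorem weakDifferential_comp (n : ℕ) (x : weakExteriorPower ℤ (n + 2) ℤ[G]) :
    weakDifferential G n (weakDifferential G (n + 1) x) = 0 :=
  Subtype.ext (antider_sq _ _ _ (WeakExteriorAlgebra.boundary_one (augmentation G))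
    (WeakExteriorAlgebra.boundary_ι_mul (augmentation G)) (n + 2) x.2)

theorem differential_comp (n : ℕ) (x : ⋀[ℤ]^(n + 2) ℤ[G]) :
    differential G n (differential G (n + 1) x) = 0 :=
  Subtype.ext (antider_sq _ _ _ (exteriorBoundary_one (augmentation G))
    (exteriorBoundary_ι_mul (augmentation G)) (n + 2) x.2)

theorem differential_ιMulti (n : ℕ) (x : Fin (n + 1) → G) :
    differential G n (exteriorPower.ιMulti ℤ (n + 1) fun i => MonoidAlgebra.of ℤ G (x i)) =
      ∑ i : Fin (n + 1), (-1 : ℤ) ^ (i : ℕ) •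
        exteriorPower.ιMulti ℤ n fun j => MonoidAlgebra.of ℤ G (x (i.succAbove j)) := by
  apply Subtype.ext
  have h := antider_prod _ _ _ (exteriorBoundary_one (augmentation G))
      (exteriorBoundary_ι_mul (augmentation G)) n fun i => MonoidAlgebra.of ℤ G (x i)
  simp only [augmentation_of, mul_one] at h
  rw [AddSubmonoidClass.coe_finsetSum]
  exact h

theorem powerRep_ιMulti (n : ℕ) (g : G) (x : Fin n → G) :
    powerRep G n g (exteriorPower.ιMulti ℤ n fun i => MonoidAlgebra.of ℤ G (x i)) =
      exteriorPower.ιMulti ℤ n fun i => MonoidAlgebra.of ℤ G (g * x i) := by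
  apply Subtype.ext
  have h := ExteriorAlgebra.map_apply_ιMulti (Representation.leftRegular ℤ G g)
    fun i => MonoidAlgebra.of ℤ G (x i)
  refine h.trans ?_
  congr 1
  funext i
  exact leftRegular_of G g (x i)

/-- The canonical projection `Λ̃ⁿ(ℤ[G]) → Λⁿ(ℤ[G])`. -/
def projection (n : ℕ) : (weakPowerRep G n).IntertwiningMap (powerRep G n) where
  toLinearMap := (WeakExteriorAlgebra.toExterior (k := ℤ) (A := ℤ[G])).toLinearMap.restrict fun _ hx =>
    map_mem_pow _ _ _ LinearMap.id WeakExteriorAlgebra.toExterior_ι n hx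
  isIntertwining' g := by
    have h : (WeakExteriorAlgebra.toExterior (k := ℤ) (A := ℤ[G])).comp
        (WeakExteriorAlgebra.map (Representation.leftRegular ℤ G g)) =
        (ExteriorAlgebra.map (Representation.leftRegular ℤ G g)).comp
          WeakExteriorAlgebra.toExterior :=
      WeakExteriorAlgebra.hom_ext fun a => by
        simp only [AlgHom.comp_apply, WeakExteriorAlgebra.map_ι, WeakExteriorAlgebra.toExterior_ι,
          ExteriorAlgebra.map_apply_ι]
    refine LinearMap.ext fun x => Subtype.ext ?_
    exact AlgHom.congr_fun h x.1

theorem projection_weakDifferential (n : ℕ) (x : weakExteriorPower ℤ (n + 1) ℤ[G]) :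
    projection G n (weakDifferential G n x) = differential G n (projection G (n + 1) x) :=
  Subtype.ext (antider_comm _ _ _ (WeakExteriorAlgebra.boundary_one (augmentation G))
      (WeakExteriorAlgebra.boundary_ι_mul (augmentation G)) _ _ _
      (exteriorBoundary_one (augmentation G)) (exteriorBoundary_ι_mul (augmentation G))
      (WeakExteriorAlgebra.toExterior (k := ℤ) (A := ℤ[G])) LinearMap.id WeakExteriorAlgebra.toExterior_ι
      (fun _ => rfl) (n + 1) x.2).symm

/-- `Δⁿ(ℤ[G])`, the kernel of the projection `Λ̃ⁿ(ℤ[G]) → Λⁿ(ℤ[G])`. -/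
abbrev Delta (n : ℕ) : Subrepresentation (weakPowerRep G n) :=
  (projection G n).ker

/-- The differential `∂ : Δⁿ⁺¹(ℤ[G]) → Δⁿ(ℤ[G])`, the restriction of that of `Λ̃`. -/
def deltaDifferential (n : ℕ) :
    (Delta G (n + 1)).toRepresentation.IntertwiningMap (Delta G n).toRepresentation where
  toLinearMap := (weakDifferential G n).toLinearMap.restrict (p := (Delta G (n + 1)).toSubmodule)
    (q := (Delta G n).toSubmodule) fun x hx => by
      change projection G n (weakDifferential G n x) = 0
      rw [projection_weakDifferential, show projection G (n + 1) x = 0 from hx, map_zero]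
  isIntertwining' g := by
    refine LinearMap.ext fun x => Subtype.ext ?_
    exact (weakDifferential G n).isIntertwining _ _ g x.1

theorem deltaDifferential_comp (n : ℕ) (x : (Delta G (n + 2)).toSubmodule) :
    deltaDifferential G n (deltaDifferential G (n + 1) x) = 0 :=
  Subtype.ext (weakDifferential_comp G n x.1)

end Chains

/-! ### Exterior cohomology and `δ`-cohomology -/

section HomComplex

variable {G : Type u} [Group G]

/-- Precomposition with a `G`-map `d : V → V'`, as a map `Hom_G(V', M) → Hom_G(V, M)`. -/
def precomp {V V' : Type u} [AddCommGroup V] [AddCommGroup V'] {ρ : Representation ℤ G V}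
    {ρ' : Representation ℤ G V'} (d : ρ.IntertwiningMap ρ')
    (M : Type v) [AddCommGroup M] [DistribMulAction G M] :
    ρ'.IntertwiningMap (Representation.ofDistribMulAction ℤ G M) →+
      ρ.IntertwiningMap (Representation.ofDistribMulAction ℤ G M) :=
  AddMonoidHom.mk' (fun f => f.comp d)
    fun f f' => Representation.IntertwiningMap.comp_add _ _ _ f f' d

/-- Given a sequence of `G`-modules and `G`-maps `⋯ → V 2 → V 1 → V 0` with square zero and a
`G`-module `M`, the cochain complex `Hom_G(V 0, M) → Hom_G(V 1, M) → ⋯`. -/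
def homComplex {V : ℕ → Type u} [∀ n, AddCommGroup (V n)] (ρ : ∀ n, Representation ℤ G (V n))
    (d : ∀ n, (ρ (n + 1)).IntertwiningMap (ρ n)) (hd : ∀ n x, d n (d (n + 1) x) = 0)
    (M : Type v) [AddCommGroup M] [DistribMulAction G M] :
    CochainComplex AddCommGrpCat.{max u v} ℕ :=
  CochainComplex.of
    (fun n => AddCommGrpCat.of
      ((ρ n).IntertwiningMap (Representation.ofDistribMulAction ℤ G M)))
    (fun n => AddCommGrpCat.ofHom (precomp (d n) M))
    (fun n => by
      refine AddCommGrpCat.hom_ext (AddMonoidHom.ext fun f => ?_)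
      refine Representation.IntertwiningMap.ext (LinearMap.ext fun x => ?_)
      change f (d n (d (n + 1) x)) = 0
      rw [hd, map_zero])

theorem homComplex_d {V : ℕ → Type u} [∀ n, AddCommGroup (V n)]
    (ρ : ∀ n, Representation ℤ G (V n)) (d : ∀ n, (ρ (n + 1)).IntertwiningMap (ρ n))
    (hd : ∀ n x, d n (d (n + 1) x) = 0) (M : Type v) [AddCommGroup M] [DistribMulAction G M]
    (n : ℕ) : (homComplex ρ d hd M).d n (n + 1) = AddCommGrpCat.ofHom (precomp (d n) M) :=
  CochainComplex.of_d (fun n => AddCommGrpCat.of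
      ((ρ n).IntertwiningMap (Representation.ofDistribMulAction ℤ G M)))
    (fun n => AddCommGrpCat.ofHom (precomp (d n) M)) n

variable (G) (M : Type v) [AddCommGroup M] [DistribMulAction G M]

/-- The cochain complex `K*_λ(G, M) = Hom_G(Λ^{*+1}(ℤ[G]), M)`. -/
def lambdaComplex : CochainComplex AddCommGrpCat.{max u v} ℕ :=
  homComplex (fun n => powerRep G (n + 1)) (fun n => differential G (n + 1))
    (fun n x => differential_comp G (n + 1) x) M

theorem lambdaComplex_d (n : ℕ) : (lambdaComplex G M).d n (n + 1) =
    AddCommGrpCat.ofHom (precomp (differential G (n + 1)) M) :=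
  homComplex_d (fun n => powerRep G (n + 1)) (fun n => differential G (n + 1))
    (fun n x => differential_comp G (n + 1) x) M n

/-- The cochain complex `Hom_G(Δ^{*+1}(ℤ[G]), M)`. -/
def deltaComplex : CochainComplex AddCommGrpCat.{max u v} ℕ :=
  homComplex (V := fun n => (Delta G (n + 1)).toSubmodule)
    (fun n => (Delta G (n + 1)).toRepresentation) (fun n => deltaDifferential G (n + 1))
    (fun n x => deltaDifferential_comp G (n + 1) x) M

theorem deltaComplex_d (n : ℕ) : (deltaComplex G M).d n (n + 1) =
    AddCommGrpCat.ofHom (precomp (deltaDifferential G (n + 1)) M) := by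
  have h := homComplex_d (V := fun n => (Delta G (n + 1)).toSubmodule)
    (fun n => (Delta G (n + 1)).toRepresentation) (fun n => deltaDifferential G (n + 1))
    (fun n x => deltaDifferential_comp G (n + 1) x) M n
  exact h

/-- The exterior cohomology groups `Hⁱ_λ(G, M)`. -/
abbrev exteriorCohomology (i : ℕ) : AddCommGrpCat.{max u v} :=
  (lambdaComplex G M).homology i

/-- The `δ`-cohomology groups `Hⁱ_δ(G, M)`. -/
abbrev deltaCohomology (i : ℕ) : AddCommGrpCat.{max u v} :=
  (deltaComplex G M).homology i

end HomComplex

/-! ### Symmetric cohomology -/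

section Cochains

variable {G : Type u} [Group G] {M : Type v} [AddCommGroup M] [DistribMulAction G M]

/-- The differential `∂ⁿ : Cⁿ(G, M) → Cⁿ⁺¹(G, M)` on inhomogeneous cochains. The term of index `j`
of the sum is `(-1)ʲ⁺¹ φ(g₀, …, gⱼ gⱼ₊₁, …, gₙ)` for `j < n` and `(-1)ⁿ⁺¹ φ(g₀, …, gₙ₋₁)` for
`j = n`. -/
def cochainD (n : ℕ) : ((Fin n → G) → M) →+ ((Fin (n + 1) → G) → M) where
  toFun φ g := g 0 • φ (fun i => g i.succ) +
    ∑ j : Fin (n + 1), (-1 : ℤ) ^ ((j : ℕ) + 1) • φ (Fin.contractNth j (· * ·) g)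
  map_zero' := by ext g; simp
  map_add' φ φ' := by
    ext g
    simp only [Pi.add_apply, smul_add, Finset.sum_add_distrib]
    abel

/-- For `g = (g₁, …, gₙ)`, the tuple `(g₁, …, gᵢ₋₁ gᵢ, gᵢ⁻¹, gᵢ gᵢ₊₁, …, gₙ)`. -/
def transposeTuple {n : ℕ} (i : Fin n) (g : Fin n → G) : Fin n → G := fun k =>
  if k = i then (g i)⁻¹
  else if (k : ℕ) + 1 = i then g k * g i
  else if (k : ℕ) = i + 1 then g i * g k
  else g k

/-- The action of the adjacent transposition `τᵢ` of the symmetric group on `n + 1` letters on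
`Cⁿ(G, M)`: `(τ₁ φ)(g₁, …, gₙ) = - g₁ φ(g₁⁻¹, g₁ g₂, g₃, …, gₙ)`, and
`(τᵢ φ)(g₁, …, gₙ) = - φ(g₁, …, gᵢ₋₁ gᵢ, gᵢ⁻¹, gᵢ gᵢ₊₁, …, gₙ)` for `i > 1`. The index
`i : Fin n` is counted from `0`. -/
def transpose {n : ℕ} (i : Fin n) : ((Fin n → G) → M) →+ ((Fin n → G) → M) where
  toFun φ g := -((if (i : ℕ) = 0 then g i else 1) • φ (transposeTuple i g))
  map_zero' := by ext g; simp
  map_add' φ φ' := by ext g; simp [add_comm]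

variable (G M) in
/-- The symmetric cochains `CSⁿ(G, M)`: the cochains that are invariant under the symmetric group
on `n + 1` letters, that is, under its generators `τᵢ`. -/
def symmetricCochains (n : ℕ) : AddSubgroup ((Fin n → G) → M) where
  carrier := {φ | ∀ i : Fin n, transpose i φ = φ}
  zero_mem' i := map_zero _
  add_mem' h h' i := by rw [map_add, h i, h' i]
  neg_mem' h i := by rw [map_neg, h i]

/-- The homogeneous cochain `(x₀, …, xₙ) ↦ x₀ φ(x₀⁻¹ x₁, …, xₙ₋₁⁻¹ xₙ)` attached to `φ`. -/
def homogenize {n : ℕ} (φ : (Fin n → G) → M) (x : Fin (n + 1) → G) : M :=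
  x 0 • φ fun i => (x i.castSucc)⁻¹ * x i.succ

theorem homogenize_partialProd {n : ℕ} (φ : (Fin n → G) → M) (g : Fin n → G) :
    homogenize φ (Fin.partialProd g) = φ g := by
  simp [homogenize, Fin.partialProd_right_inv]

theorem homogenize_smul {n : ℕ} (φ : (Fin n → G) → M) (s : G) (x : Fin (n + 1) → G) :
    homogenize φ (fun i => s * x i) = s • homogenize φ x := by
  simp [homogenize, mul_smul, mul_assoc]

theorem homogenize_injective {n : ℕ} {φ φ' : (Fin n → G) → M}
    (h : ∀ x, homogenize φ x = homogenize φ' x) : φ = φ' := by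
  funext g
  rw [← homogenize_partialProd φ, h, homogenize_partialProd]

theorem homogenize_cochainD {n : ℕ} (φ : (Fin n → G) → M) (x : Fin (n + 2) → G) :
    homogenize (cochainD n φ) x =
      ∑ i : Fin (n + 2), (-1 : ℤ) ^ (i : ℕ) • homogenize φ (fun j => x (i.succAbove j)) := by
  have key : ∀ g : Fin (n + 1) → G, homogenize (cochainD n φ) (Fin.partialProd g) =
      ∑ i : Fin (n + 2), (-1 : ℤ) ^ (i : ℕ) •
        homogenize φ (fun j => Fin.partialProd g (i.succAbove j)) := by
    intro g
    rw [homogenize_partialProd, Fin.sum_univ_succ]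
    refine congrArg₂ (fun a b : M => a + b) ?_ ?_
    · simp only [Fin.val_zero, pow_zero, one_smul, Fin.succAbove_zero, Fin.partialProd_succ']
      rw [homogenize_smul]
      exact congrArg _ (homogenize_partialProd φ _).symm
    · refine Finset.sum_congr rfl fun j _ => ?_
      rw [← homogenize_partialProd φ, Fin.partialProd_contractNth]
      rfl
  have hx := Fin.partialProd_left_inv x
  have hx2 : x = fun i => x 0 * Fin.partialProd (fun i => (x i.castSucc)⁻¹ * x i.succ) i :=
    hx.symm
  rw [hx2, homogenize_smul, key, Finset.smul_sum]
  refine Finset.sum_congr rfl fun i _ => ?_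
  rw [smul_comm, homogenize_smul φ (x 0) (fun j => Fin.partialProd _ (i.succAbove j))]

theorem cochainD_comp (n : ℕ) (φ : (Fin n → G) → M) : cochainD (n + 1) (cochainD n φ) = 0 := by
  apply homogenize_injective
  intro x
  rw [homogenize_cochainD]
  simp only [homogenize_cochainD, Finset.smul_sum]
  rw [← Finset.sum_product', show homogenize (0 : (Fin (n + 2) → G) → M) x = 0 by
    simp [homogenize]]
  refine Finset.sum_involution (fun p _ => (p.1.succAbove p.2, p.2.predAbove p.1)) ?_ ?_ ?_ ?_
  · rintro ⟨i, j⟩ -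
    simp only [Fin.succAbove_succAbove_succAbove_predAbove, smul_smul, ← pow_add]
    rw [Fin.neg_one_pow_succAbove_add_predAbove, neg_smul, add_neg_cancel]
  · rintro ⟨i, j⟩ - - h
    exact Fin.succAbove_ne i j (congrArg Prod.fst h)
  · intros; exact Finset.mem_univ _
  · rintro ⟨i, j⟩ -
    simp [Fin.succAbove_succAbove_predAbove, Fin.predAbove_predAbove_succAbove]

theorem homogenize_transpose {n : ℕ} (i : Fin n) (φ : (Fin n → G) → M) (x : Fin (n + 1) → G) :
    homogenize (transpose i φ) x =
      -homogenize φ (fun k => x (Equiv.swap i.castSucc i.succ k)) := by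
  have h1 : transposeTuple i (fun k => (x k.castSucc)⁻¹ * x k.succ) =
      fun k : Fin n => (x (Equiv.swap i.castSucc i.succ k.castSucc))⁻¹ *
        x (Equiv.swap i.castSucc i.succ k.succ) := by
    funext k
    unfold transposeTuple
    split_ifs with h h' h'
    · subst h; simp
    · have e : k.succ = i.castSucc := Fin.ext (by simpa using h')
      have e1 : k.castSucc ≠ i.castSucc := fun e => h (Fin.castSucc_injective _ e)
      have e2 : k.castSucc ≠ i.succ := fun e => by
        have := congrArg Fin.val e; simp at this; omega
      rw [Equiv.swap_apply_of_ne_of_ne e1 e2, e, Equiv.swap_apply_left]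
      simp only
      rw [e, mul_assoc, mul_inv_cancel_left]
    · have e : k.castSucc = i.succ := Fin.ext (by simpa using h')
      have e1 : k.succ ≠ i.castSucc := fun e => by
        have := congrArg Fin.val e; simp at this; omega
      have e2 : k.succ ≠ i.succ := fun e => h (Fin.succ_injective _ e)
      rw [Equiv.swap_apply_of_ne_of_ne e1 e2, e, Equiv.swap_apply_right]
      simp only
      rw [e, mul_assoc, mul_inv_cancel_left]
    · have hne : (k : ℕ) ≠ i := fun e => h (Fin.ext e)
      rw [Equiv.swap_apply_of_ne_of_ne, Equiv.swap_apply_of_ne_of_ne] <;>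
      · intro e
        have := congrArg Fin.val e
        simp at this
        omega
  have h2 : x 0 * (if (i : ℕ) = 0 then (x i.castSucc)⁻¹ * x i.succ else 1) =
      x (Equiv.swap i.castSucc i.succ 0) := by
    split_ifs with h
    · have e : (0 : Fin (n + 1)) = i.castSucc := Fin.ext (by simp [h])
      rw [e, Equiv.swap_apply_left, mul_inv_cancel_left]
    · rw [mul_one, Equiv.swap_apply_of_ne_of_ne]
      · intro e
        have := congrArg Fin.val e
        simp at this
        omega
      · intro e
        have := congrArg Fin.val e
        simp at this
  change x 0 • -(_ • φ (transposeTuple i _)) = -(_ • φ _)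
  rw [h1, smul_neg, smul_smul, h2]

theorem mem_symmetricCochains_iff {n : ℕ} (φ : (Fin n → G) → M) :
    φ ∈ symmetricCochains G M n ↔ ∀ (i : Fin n) (x : Fin (n + 1) → G),
      homogenize φ (fun k => x (Equiv.swap i.castSucc i.succ k)) = -homogenize φ x := by
  constructor
  · intro h i x
    conv_rhs => rw [← h i, homogenize_transpose, neg_neg]
  · intro h i
    apply homogenize_injective
    intro x
    rw [homogenize_transpose, h, neg_neg]

theorem homogenize_perm {n : ℕ} {φ : (Fin n → G) → M} (hφ : φ ∈ symmetricCochains G M n)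
    (σ : Equiv.Perm (Fin (n + 1))) : ∀ x : Fin (n + 1) → G,
      homogenize φ (fun k => x (σ k)) = (Equiv.Perm.sign σ : ℤ) • homogenize φ x := by
  have hσ : σ ∈ Submonoid.closure
      (Set.range fun i : Fin n => Equiv.swap i.castSucc i.succ) := by
    rw [Equiv.Perm.mclosure_swap_castSucc_succ]; trivial
  induction hσ using Submonoid.closure_induction with
  | mem σ h =>
    obtain ⟨i, rfl⟩ := h
    intro x
    rw [(mem_symmetricCochains_iff φ).1 hφ i x, Equiv.Perm.sign_swap i.castSucc_lt_succ.ne]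
    simp
  | one => intro x; simp
  | mul σ τ _ _ h h' =>
    intro x
    have := h' (fun k => x (σ k))
    rw [Equiv.Perm.sign_mul, mul_comm, Units.val_mul, mul_smul, ← h x]
    exact this

theorem cochainD_mem {n : ℕ} {φ : (Fin n → G) → M} (hφ : φ ∈ symmetricCochains G M n) :
    cochainD n φ ∈ symmetricCochains G M (n + 1) := by
  rw [mem_symmetricCochains_iff]
  intro a x
  rw [homogenize_cochainD, homogenize_cochainD, ← Finset.sum_neg_distrib]
  refine Fintype.sum_equiv (Equiv.swap a.castSucc a.succ) _ _ fun i => ?_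
  by_cases h1 : i = a.castSucc
  · subst h1
    rw [Equiv.swap_apply_left, Fin.val_succ, pow_succ, Fin.val_castSucc]
    have : (fun j => x (Equiv.swap a.castSucc a.succ (a.castSucc.succAbove j))) =
        fun j => x (a.succ.succAbove j) := by
      funext j
      congr 1
      rcases lt_trichotomy j a with h | h | h
      · rw [Fin.succAbove_castSucc_of_lt _ _ h, Fin.succAbove_succ_of_le _ _ h.le,
          Equiv.swap_apply_of_ne_of_ne]
        · exact fun e => h.ne (Fin.castSucc_injective _ e)
        · intro e; have := congrArg Fin.val e; simp at this; omega
      · subst h; simp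
      · rw [Fin.succAbove_castSucc_of_le _ _ h.le, Fin.succAbove_succ_of_lt _ _ h,
          Equiv.swap_apply_of_ne_of_ne]
        · intro e; have := congrArg Fin.val e; simp at this; omega
        · exact fun e => h.ne' (Fin.succ_injective _ e)
    rw [this]
    simp
  by_cases h2 : i = a.succ
  · subst h2
    rw [Equiv.swap_apply_right, Fin.val_succ, pow_succ, Fin.val_castSucc]
    have : (fun j => x (Equiv.swap a.castSucc a.succ (a.succ.succAbove j))) =
        fun j => x (a.castSucc.succAbove j) := by
      funext j
      congr 1
      rcases lt_trichotomy j a with h | h | h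
      · rw [Fin.succAbove_castSucc_of_lt _ _ h, Fin.succAbove_succ_of_le _ _ h.le,
          Equiv.swap_apply_of_ne_of_ne]
        · exact fun e => h.ne (Fin.castSucc_injective _ e)
        · intro e; have := congrArg Fin.val e; simp at this; omega
      · subst h; simp
      · rw [Fin.succAbove_castSucc_of_le _ _ h.le, Fin.succAbove_succ_of_lt _ _ h,
          Equiv.swap_apply_of_ne_of_ne]
        · intro e; have := congrArg Fin.val e; simp at this; omega
        · exact fun e => h.ne' (Fin.succ_injective _ e)
    rw [this]
    simp
  · rw [Equiv.swap_apply_of_ne_of_ne h1 h2, ← smul_neg]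
    congr 1
    obtain ⟨b, hb⟩ := Fin.exists_succAbove_eq (Ne.symm h1)
    obtain ⟨c, hc⟩ := Fin.exists_succAbove_eq (Ne.symm h2)
    have hbc : b ≠ c := by
      rintro rfl
      exact a.castSucc_lt_succ.ne (hb.symm.trans hc)
    have hswap : ∀ j, Equiv.swap a.castSucc a.succ (i.succAbove j) =
        i.succAbove (Equiv.swap b c j) := fun j => by
      rw [← hb, ← hc]
      exact (Function.Injective.map_swap Fin.succAbove_right_injective b c j).symm
    simp only [hswap]
    rw [homogenize_perm hφ (Equiv.swap b c) fun j => x (i.succAbove j),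
      Equiv.Perm.sign_swap hbc]
    simp

end Cochains

section Comparison

variable (G : Type u) [Group G] (M : Type v) [AddCommGroup M] [DistribMulAction G M]

/-- The restriction `CSⁿ(G, M) → CSⁿ⁺¹(G, M)` of the differential. -/
def symmetricD (n : ℕ) : symmetricCochains G M n →+ symmetricCochains G M (n + 1) :=
  ((cochainD n).comp (symmetricCochains G M n).subtype).codRestrict
    (symmetricCochains G M (n + 1)) fun φ => cochainD_mem φ.2

/-- The complex `CS*(G, M)` of symmetric cochains, a subcomplex of the complex of inhomogeneous
cochains. -/
def symmetricComplex : CochainComplex AddCommGrpCat.{max u v} ℕ :=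
  CochainComplex.of (fun n => AddCommGrpCat.of (symmetricCochains G M n))
    (fun n => AddCommGrpCat.ofHom (symmetricD G M n))
    (fun n => by
      refine AddCommGrpCat.hom_ext (AddMonoidHom.ext fun φ => Subtype.ext ?_)
      exact cochainD_comp n φ.1)

theorem symmetricComplex_d (n : ℕ) :
    (symmetricComplex G M).d n (n + 1) = AddCommGrpCat.ofHom (symmetricD G M n) :=
  CochainComplex.of_d (fun n => AddCommGrpCat.of (symmetricCochains G M n))
    (fun n => AddCommGrpCat.ofHom (symmetricD G M n)) n

/-- The symmetric cohomology groups `HSⁱ(G, M)`. -/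
abbrev symmetricCohomology (i : ℕ) : AddCommGrpCat.{max u v} :=
  (symmetricComplex G M).homology i

variable {G M}

/-- The inhomogeneous cochain `(g₁, …, gₙ) ↦ f(1 ∧ g₁ ∧ g₁ g₂ ∧ ⋯ ∧ g₁ ⋯ gₙ)` attached to a
`G`-map `f : Λⁿ⁺¹(ℤ[G]) → M`. -/
def toCochain {n : ℕ} (f : (powerRep G (n + 1)).IntertwiningMap
    (Representation.ofDistribMulAction ℤ G M)) (g : Fin n → G) : M :=
  f (exteriorPower.ιMulti ℤ (n + 1) fun i => MonoidAlgebra.of ℤ G (Fin.partialProd g i))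

theorem homogenize_toCochain {n : ℕ} (f : (powerRep G (n + 1)).IntertwiningMap
    (Representation.ofDistribMulAction ℤ G M)) (x : Fin (n + 1) → G) :
    homogenize (toCochain f) x =
      f (exteriorPower.ιMulti ℤ (n + 1) fun i => MonoidAlgebra.of ℤ G (x i)) := by
  have h := f.isIntertwining _ _ (x 0) (exteriorPower.ιMulti ℤ (n + 1) fun i =>
    MonoidAlgebra.of ℤ G (Fin.partialProd (fun i => (x i.castSucc)⁻¹ * x i.succ) i))
  rw [powerRep_ιMulti, Representation.ofDistribMulAction_apply_apply] at h
  refine h.symm.trans ?_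
  have hx := Fin.partialProd_left_inv x
  conv_rhs => rw [← hx]
  rfl

theorem toCochain_mem {n : ℕ} (f : (powerRep G (n + 1)).IntertwiningMap
    (Representation.ofDistribMulAction ℤ G M)) : toCochain f ∈ symmetricCochains G M n := by
  rw [mem_symmetricCochains_iff]
  intro i x
  rw [homogenize_toCochain, homogenize_toCochain, ← map_neg]
  congr 1
  exact (exteriorPower.ιMulti ℤ (n + 1)).map_swap
    (fun k => MonoidAlgebra.of ℤ G (x k)) i.castSucc_lt_succ.ne

theorem cochainD_toCochain {n : ℕ} (f : (powerRep G (n + 1)).IntertwiningMap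
    (Representation.ofDistribMulAction ℤ G M)) :
    cochainD n (toCochain f) = toCochain (f.comp (differential G (n + 1))) := by
  apply homogenize_injective
  intro x
  rw [homogenize_cochainD, homogenize_toCochain, Representation.IntertwiningMap.comp_apply,
    differential_ιMulti, map_sum]
  refine Finset.sum_congr rfl fun i _ => ?_
  rw [homogenize_toCochain, map_zsmul]

variable (G M)

/-- The morphism of complexes `K*_λ(G, M) → CS*(G, M)`. -/
def gammaComplex : lambdaComplex G M ⟶ symmetricComplex G M :=
  CochainComplex.ofHom
    (fun n => AddCommGrpCat.ofHom (AddMonoidHom.mk'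
      (fun f => (⟨toCochain f, toCochain_mem f⟩ : symmetricCochains G M n))
      (fun _ _ => rfl)))
    (fun n => by
      rw [symmetricComplex_d, lambdaComplex_d]
      refine AddCommGrpCat.hom_ext (AddMonoidHom.ext fun f => Subtype.ext ?_)
      exact cochainD_toCochain f)

/-- The natural map `γⁱ : Hⁱ_λ(G, M) → HSⁱ(G, M)`. -/
abbrev gamma (i : ℕ) : exteriorCohomology G M i ⟶ symmetricCohomology G M i :=
  HomologicalComplex.homologyMap (gammaComplex G M) i

end Comparison

end SymmetricCohomology

end

/-!
# Vanishing of `δ`-cohomology in degrees at most four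

The weak exterior power `Λ̃ⁿ(ℤ[G])` is generated by the products of `n` elements of `G`. Reordering
a product changes at most its sign, so that a product with a repetition is killed by two
(`groupProd_add_self`). The boundary of a product of distinct elements only involves products of
distinct elements. Hence sending a product of distinct elements to itself and a product
with a repetition to zero defines a `G`-equivariant section of `Λ̃ → Λ` which is a morphism of
complexes (`sectionMap_differential`), and `Λ̃` is the direct sum of `Λ` and `Δ` as a complex of
`G`-modules. The complex `CS*(G, M)` is isomorphic to `Hom_G(Λ̃^{*+1}(ℤ[G]), M)`
(`isIso_weakGamma`), and under this isomorphism `γ` is induced by `Λ̃ → Λ`. So `γⁱ` is the inclusion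
of a direct summand whose complement is `Hⁱ_δ(G, M)`, and it remains to show that the latter
vanishes for `i ≤ 4`.

A `G`-map `Δⁿ⁺¹(ℤ[G]) → M` amounts to an equivariant function `c` of multisets of `n + 1` elements
of `G`, with values killed by two and zero on multisets without repetition. Its
coboundary at `x` is the sum of the values `c(x - a)` for `a` in `x` (`multisetLift_boundary`). If
`c` is a cocycle, put `b(y) = c(t + y)`, where `t` is an element repeated in `y`. The cocycle
condition at `t + x`, with `t` repeated in `x`, shows that `b` has coboundary `c`
(`multisetD_cone`). For `b` to be equivariant, it has to be independent of the choice of `t`. If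
`y` has at most four elements and `t ≠ t'` are both repeated in `y`, then `y = 2t + 2t'`, and the
cocycle condition at `3t + 3t'` gives `c(t + y) = c(t' + y)` (`cone_unique`). This is the only step
that uses `i ≤ 4`.

Linear maps out of `Λ̃(k[G])` and `Λ(k[G])` are constructed from functions `β` of lists of elements
of `G` that are skew, respectively alternating, with respect to neighbouring entries: the algebra
acts on the space of such functions, `g` sending `β` to `β(· ++ [g])`, and the linear map evaluates
`x β` at the empty list (`weakLift`, `exteriorLift`).
-/

noncomputable section

namespace SymmetricCohomology

open CategoryTheory
open scoped MonoidAlgebra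

universe w u v

/-! ### Products of group elements -/

section Products

variable {k : Type w} [CommRing k] {G : Type u} [Group G] {R : Type*} [Ring R]
  [Algebra k R] (u : k[G] →ₗ[k] R)

/-- The product `u(g₁) ⋯ u(gₙ)` in `R` attached to a list `[g₁, …, gₙ]` of elements of `G`. -/
def groupProd (l : List G) : R := (l.map fun g => u (MonoidAlgebra.of k G g)).prod

@[simp] theorem groupProd_nil : groupProd u [] = 1 := rfl

@[simp] theorem groupProd_cons (g : G) (l : List G) :
    groupProd u (g :: l) = u (MonoidAlgebra.of k G g) * groupProd u l := by
  simp [groupProd]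

theorem groupProd_append (l l' : List G) :
    groupProd u (l ++ l') = groupProd u l * groupProd u l' := by
  simp [groupProd]

theorem groupProd_mem {l : List G} {n : ℕ} (hl : l.length = n) :
    groupProd u l ∈ LinearMap.range u ^ n := by
  subst hl
  induction l with
  | nil => exact Submodule.one_le.1 (pow_zero _).ge
  | cons g l ih =>
    rw [groupProd_cons, List.length_cons, pow_succ']
    exact Submodule.mul_mem_mul ⟨_, rfl⟩ ih

/-- The degree `n` part is spanned by the products of `n` elements of `G`. -/
theorem range_pow_le_span (n : ℕ) :
    LinearMap.range u ^ n ≤ Submodule.span k (groupProd u '' {l | l.length = n}) := by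
  induction n with
  | zero =>
    rw [pow_zero, Submodule.one_le]
    exact Submodule.subset_span ⟨[], rfl, rfl⟩
  | succ n ih =>
    rw [pow_succ', Submodule.mul_le]
    rintro _ ⟨a, rfl⟩ y hy
    have hy' := ih hy
    clear hy
    induction hy' using Submodule.span_induction with
    | mem y h =>
      obtain ⟨l, hl, rfl⟩ := h
      induction a using MonoidAlgebra.induction_on with
      | of g => exact Submodule.subset_span ⟨g :: l, by simpa using hl, groupProd_cons u g l⟩
      | add a b ha hb => rw [map_add, add_mul]; exact Submodule.add_mem _ ha hb
      | smul r a ha => rw [map_smul, smul_mul_assoc]; exact Submodule.smul_mem _ r ha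
    | zero => simp
    | add x y _ _ hx hy => rw [mul_add]; exact Submodule.add_mem _ hx hy
    | smul r x _ hx => rw [mul_smul_comm]; exact Submodule.smul_mem _ r hx

variable {u} in
/-- A linear map on the degree `n` part is determined by its values on products of `n` elements
of `G`. -/
theorem range_pow_hom_ext {N : Type*} [AddCommGroup N] [Module k N] {n : ℕ}
    {F F' : ↥(LinearMap.range u ^ n) →ₗ[k] N}
    (h : ∀ (l : List G) (hl : l.length = n),
      F ⟨groupProd u l, groupProd_mem u hl⟩ = F' ⟨groupProd u l, groupProd_mem u hl⟩) : F = F' := by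
  ext ⟨x, hx⟩
  suffices ∀ x ∈ Submodule.span k (groupProd u '' {l | l.length = n}),
      ∀ hx : x ∈ LinearMap.range u ^ n, F ⟨x, hx⟩ = F' ⟨x, hx⟩ from
    this x (range_pow_le_span u n hx) hx
  intro x hx
  have hle : Submodule.span k (groupProd u '' {l | l.length = n}) ≤ LinearMap.range u ^ n := by
    rw [Submodule.span_le]
    rintro _ ⟨l, hl, rfl⟩
    exact groupProd_mem u hl
  induction hx using Submodule.span_induction with
  | mem x h =>
    obtain ⟨l, hl, rfl⟩ := h
    intro _
    exact h l hl
  | zero => intro _; exact (map_zero F).trans (map_zero F').symm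
  | add x y hx hy h h' =>
    intro _
    have e := map_add F ⟨x, hle hx⟩ ⟨y, hle hy⟩
    rw [h, h', ← map_add] at e
    exact e
  | smul r x hx h =>
    intro _
    have e := map_smul F r ⟨x, hle hx⟩
    rw [h, ← map_smul] at e
    exact e

end Products

/-! ### Linear maps defined by functions of lists -/

section Lift

variable (k : Type w) [CommRing k] (G : Type u) (N : Type*) [AddCommGroup N] [Module k N]

/-- The functions of lists of elements of `G` that change sign when two neighbouring entries are
exchanged. -/
def skewListFun : Submodule k (List G → N) where
  carrier := {β | ∀ s a b l, β (s ++ a :: b :: l) + β (s ++ b :: a :: l) = 0}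
  zero_mem' := by simp
  add_mem' {β γ} h h' s a b l := by
    rw [Pi.add_apply, Pi.add_apply, add_add_add_comm, h, h', add_zero]
  smul_mem' r β h s a b l := by
    rw [Pi.smul_apply, Pi.smul_apply, ← smul_add, h, smul_zero]

/-- The skew functions of lists of elements of `G` that vanish when two neighbouring entries are
equal. -/
def altListFun : Submodule k (List G → N) where
  carrier := {β | β ∈ skewListFun k G N ∧ ∀ s a l, β (s ++ a :: a :: l) = 0}
  zero_mem' := ⟨zero_mem _, by simp⟩
  add_mem' {β γ} h h' := ⟨add_mem h.1 h'.1, fun s a l => by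
    rw [Pi.add_apply, h.2, h'.2, add_zero]⟩
  smul_mem' r β h := ⟨Submodule.smul_mem _ r h.1, fun s a l => by
    rw [Pi.smul_apply, h.2, smul_zero]⟩

variable {k G N} {S : Submodule k (List G → N)}

theorem skewListFun_append (g : G) (β : List G → N) (hβ : β ∈ skewListFun k G N) :
    (fun s => β (s ++ [g])) ∈ skewListFun k G N := fun s a b l => by
  simpa using hβ s a b (l ++ [g])

theorem altListFun_append (g : G) (β : List G → N) (hβ : β ∈ altListFun k G N) :
    (fun s => β (s ++ [g])) ∈ altListFun k G N :=
  ⟨skewListFun_append g β hβ.1, fun s a l => by simpa using hβ.2 s a (l ++ [g])⟩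

variable [Group G]

/-- The action of the group ring on a space of functions of lists of elements of `G` in which `g`
sends `β` to `s ↦ β (s ++ [g])`. -/
def appendOp (hS : ∀ g, ∀ β ∈ S, (fun s => β (s ++ [g])) ∈ S) : k[G] →ₗ[k] Module.End k S :=
  Finsupp.linearCombination k (fun g : G => LinearMap.restrict
      (LinearMap.funLeft k N fun s : List G => s ++ [g]) (hS g)) ∘ₗ
    (MonoidAlgebra.coeffLinearEquiv (M := G) k).toLinearMap

theorem appendOp_of (hS : ∀ g, ∀ β ∈ S, (fun s => β (s ++ [g])) ∈ S) (g : G) (β : S)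
    (s : List G) : (appendOp hS (MonoidAlgebra.of k G g) β : List G → N) s = β.1 (s ++ [g]) := by
  simp [appendOp, LinearMap.funLeft]

theorem groupProd_appendOp (hS : ∀ g, ∀ β ∈ S, (fun s => β (s ++ [g])) ∈ S) (β : S)
    (l s : List G) :
    (groupProd (R := Module.End k S) (appendOp hS) l β : List G → N) s = β.1 (s ++ l) := by
  induction l generalizing s with
  | nil => simp
  | cons g l ih =>
    rw [groupProd_cons, Module.End.mul_apply, appendOp_of, ih, List.append_assoc]
    rfl

theorem appendOp_skew (hS : ∀ g, ∀ β ∈ S, (fun s => β (s ++ [g])) ∈ S)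
    (hle : S ≤ skewListFun k G N) (a b : k[G]) :
    appendOp hS a * appendOp hS b + appendOp hS b * appendOp hS a = 0 := by
  induction a using MonoidAlgebra.induction_on with
  | of g =>
    induction b using MonoidAlgebra.induction_on with
    | of h =>
      ext β s
      have := hle β.2 s g h []
      rw [LinearMap.add_apply, Submodule.coe_add, Pi.add_apply, Module.End.mul_apply,
        Module.End.mul_apply, appendOp_of, appendOp_of, appendOp_of, appendOp_of]
      simpa using this
    | add b c hb hc =>
      rw [map_add, mul_add, add_mul, add_add_add_comm, hb, hc, add_zero]
    | smul r b hb => rw [map_smul, mul_smul_comm, smul_mul_assoc, ← smul_add, hb, smul_zero]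
  | add b c hb hc =>
    rw [map_add, mul_add, add_mul, add_add_add_comm, hb, hc, add_zero]
  | smul r b hb => rw [map_smul, mul_smul_comm, smul_mul_assoc, ← smul_add, hb, smul_zero]

/-- The square of the operator of `a` is a quadratic function of `a` whose polar form
vanishes by `appendOp_skew`, so that its vanishing on `G` suffices. -/
theorem appendOp_sq (a : k[G]) :
    appendOp (S := altListFun k G N) altListFun_append a * appendOp altListFun_append a = 0 := by
  have hskew := appendOp_skew (S := altListFun k G N) altListFun_append fun β h => h.1
  induction a using MonoidAlgebra.induction_on with
  | of g =>
    ext β s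
    have := β.2.2 s g []
    rw [Module.End.mul_apply, appendOp_of, appendOp_of]
    simpa using this
  | add a b ha hb =>
    rw [map_add, mul_add, add_mul, add_mul, ha, hb, zero_add, add_zero, add_comm, hskew]
  | smul r a ha => rw [map_smul, mul_smul_comm, smul_mul_assoc, ha, smul_zero, smul_zero]

theorem map_groupProd {R R' : Type*} [Ring R] [Algebra k R] [Ring R'] [Algebra k R']
    {u : k[G] →ₗ[k] R} {u' : k[G] →ₗ[k] R'} (T : R →ₐ[k] R') (h : ∀ a, T (u a) = u' a)
    (l : List G) :
    T (groupProd u l) = groupProd u' l := by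
  simp [groupProd, map_list_prod, Function.comp_def, h]

theorem map_groupProd_map {R : Type*} [Ring R] [Algebra k R] {u : k[G] →ₗ[k] R} (T : R →ₐ[k] R)
    (g : G) (h : ∀ a, T (u a) = u (Representation.leftRegular k G g a)) (l : List G) :
    T (groupProd u l) = groupProd u (l.map (g * ·)) := by
  simp [groupProd, map_list_prod, Function.comp_def, h]

variable (k G N) in
/-- The action of `Λ̃(k[G])` on the skew functions of lists. -/
def weakAct : WeakExteriorAlgebra k k[G] →ₐ[k] Module.End k (skewListFun k G N) :=
  WeakExteriorAlgebra.lift (B := Module.End k (skewListFun k G N))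
    (appendOp (S := skewListFun k G N) skewListFun_append)
    (appendOp_skew (S := skewListFun k G N) skewListFun_append le_rfl)

/-- The linear map `Λ̃(k[G]) → N` attached to a skew function `β` on lists, with
`g₁ ∧̃ ⋯ ∧̃ gₙ ↦ β(g₁, …, gₙ)`. -/
def weakLift (β : List G → N) (hβ : β ∈ skewListFun k G N) :
    WeakExteriorAlgebra k k[G] →ₗ[k] N where
  toFun x := (weakAct k G N x ⟨β, hβ⟩ : List G → N) []
  map_add' x y := by rw [map_add]; rfl
  map_smul' r x := by rw [map_smul]; rfl

theorem weakLift_groupProd (β : List G → N) (hβ : β ∈ skewListFun k G N) (l : List G) :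
    weakLift β hβ (groupProd (WeakExteriorAlgebra.ι k) l) = β l := by
  have h := map_groupProd (R := WeakExteriorAlgebra k k[G])
    (R' := Module.End k (skewListFun k G N)) (u := WeakExteriorAlgebra.ι k)
    (u' := appendOp (S := skewListFun k G N) skewListFun_append) (weakAct k G N)
    (fun a => WeakExteriorAlgebra.lift_ι _ _ a) l
  have h' := groupProd_appendOp (S := skewListFun k G N) skewListFun_append ⟨β, hβ⟩ l []
  rw [← h] at h'
  exact h'

variable (k G N) in
/-- The action of `Λ(k[G])` on the alternating functions of lists. -/
def exteriorAct : ExteriorAlgebra k k[G] →ₐ[k] Module.End k (altListFun k G N) :=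
  ExteriorAlgebra.lift k
    ⟨appendOp (S := altListFun k G N) altListFun_append, appendOp_sq (k := k) (G := G) (N := N)⟩

/-- The linear map `Λ(k[G]) → N` attached to an alternating function `β` on lists, with
`g₁ ∧ ⋯ ∧ gₙ ↦ β(g₁, …, gₙ)`. -/
def exteriorLift (β : List G → N) (hβ : β ∈ altListFun k G N) :
    ExteriorAlgebra k k[G] →ₗ[k] N where
  toFun x := (exteriorAct k G N x ⟨β, hβ⟩ : List G → N) []
  map_add' x y := by rw [map_add]; rfl
  map_smul' r x := by rw [map_smul]; rfl

theorem exteriorLift_groupProd (β : List G → N) (hβ : β ∈ altListFun k G N) (l : List G) :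
    exteriorLift β hβ (groupProd (ExteriorAlgebra.ι k) l) = β l := by
  have h := map_groupProd (R := ExteriorAlgebra k k[G])
    (R' := Module.End k (altListFun k G N)) (u := ExteriorAlgebra.ι k)
    (u' := appendOp (S := altListFun k G N) altListFun_append) (exteriorAct k G N)
    (fun a => ExteriorAlgebra.lift_ι_apply k _ _ a) l
  have h' := groupProd_appendOp (S := altListFun k G N) altListFun_append ⟨β, hβ⟩ l []
  rw [← h] at h'
  exact h'

end Lift

/-! ### The section of the projection from the weak exterior algebra -/

section Section

open Classical in
theorem exists_perm_cons_cons_of_not_nodup {α : Type*} {l : List α} (hl : ¬ l.Nodup) :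
    ∃ a l', l.Perm (a :: a :: l') := by
  obtain ⟨a, ha⟩ := List.exists_duplicate_iff_not_nodup.2 hl
  obtain ⟨l', h⟩ := (List.duplicate_iff_sublist.1 ha).exists_perm_append
  exact ⟨a, l', by simpa using h⟩

variable {k : Type w} [CommRing k] {G : Type u} [Group G]

/-- Products in `Λ̃(k[G])` of the same elements in different orders agree up to sign. -/
theorem groupProd_perm {l l' : List G} (h : l.Perm l') :
    groupProd (WeakExteriorAlgebra.ι k) l = groupProd (WeakExteriorAlgebra.ι k) l' ∨
      groupProd (WeakExteriorAlgebra.ι k) l = -groupProd (WeakExteriorAlgebra.ι k) l' := by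
  induction h with
  | nil => exact Or.inl rfl
  | cons x _ ih =>
    rw [groupProd_cons, groupProd_cons]
    rcases ih with ih | ih <;> simp [ih]
  | swap x y l =>
    right
    simp only [groupProd_cons, ← mul_assoc]
    rw [← neg_mul, eq_neg_of_add_eq_zero_left (WeakExteriorAlgebra.ι_skew (k := k) _ _)]
  | trans _ _ ih ih' =>
    rcases ih with ih | ih <;> rcases ih' with ih' | ih' <;> simp [ih, ih']

/-- A product in `Λ̃(k[G])` with a repetition is killed by two: exchanging the equal factors
changes its sign. -/
theorem groupProd_add_self {l : List G} (hl : ¬ l.Nodup) :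
    groupProd (WeakExteriorAlgebra.ι k) l + groupProd (WeakExteriorAlgebra.ι k) l = 0 := by
  obtain ⟨a, l', h⟩ := exists_perm_cons_cons_of_not_nodup hl
  have key : groupProd (WeakExteriorAlgebra.ι k) (a :: a :: l') +
      groupProd (WeakExteriorAlgebra.ι k) (a :: a :: l') = 0 := by
    simp only [groupProd_cons, ← mul_assoc]
    rw [← add_mul, WeakExteriorAlgebra.ι_skew, zero_mul]
  rcases groupProd_perm (k := k) h with h | h <;> rw [h]
  · exact key
  · rw [← neg_add, key, neg_zero]

open Classical in
variable (k) in
/-- The product in `Λ̃(k[G])` of a list of elements of `G`, replaced by zero if there is a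
repetition. -/
def nodupProd (l : List G) : WeakExteriorAlgebra k k[G] :=
  if l.Nodup then groupProd (WeakExteriorAlgebra.ι k) l else 0

theorem nodupProd_of_nodup {l : List G} (h : l.Nodup) :
    nodupProd k l = groupProd (WeakExteriorAlgebra.ι k) l := if_pos h

theorem nodupProd_of_not_nodup {l : List G} (h : ¬ l.Nodup) : nodupProd k l = 0 := if_neg h

theorem nodupProd_mem : nodupProd k ∈ altListFun k G (WeakExteriorAlgebra k k[G]) := by
  refine ⟨fun s a b l => ?_, fun s a l => nodupProd_of_not_nodup fun h => ?_⟩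
  · have hp : (s ++ a :: b :: l).Perm (s ++ b :: a :: l) := (List.Perm.swap b a l).append_left s
    by_cases h : (s ++ a :: b :: l).Nodup
    · rw [nodupProd_of_nodup h, nodupProd_of_nodup (hp.nodup_iff.1 h), groupProd_append,
        groupProd_append, ← mul_add]
      simp only [groupProd_cons, ← mul_assoc]
      rw [← add_mul, WeakExteriorAlgebra.ι_skew, zero_mul, mul_zero]
    · rw [nodupProd_of_not_nodup h, nodupProd_of_not_nodup (h ∘ hp.nodup_iff.2), add_zero]
  · have := (List.nodup_append.1 h).2.1
    simp at this

variable (k G) in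
/-- The linear section `Λ(k[G]) → Λ̃(k[G])` of the canonical projection that sends a product of
distinct elements of `G` to the product of the same elements. -/
def exteriorSection : ExteriorAlgebra k k[G] →ₗ[k] WeakExteriorAlgebra k k[G] :=
  exteriorLift (nodupProd k) nodupProd_mem

theorem exteriorSection_groupProd (l : List G) :
    exteriorSection k G (groupProd (ExteriorAlgebra.ι k) l) = nodupProd k l :=
  exteriorLift_groupProd _ _ l

theorem exteriorSection_mem (n : ℕ) {x : ExteriorAlgebra k k[G]} (hx : x ∈ ⋀[k]^n k[G]) :
    exteriorSection k G x ∈ weakExteriorPower k n k[G] := by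
  have h : Submodule.span k (groupProd (ExteriorAlgebra.ι k) '' {l : List G | l.length = n}) ≤
      (weakExteriorPower k n k[G]).comap (exteriorSection k G) := by
    rw [Submodule.span_le]
    rintro _ ⟨l, hl, rfl⟩
    change exteriorSection k G _ ∈ weakExteriorPower k n k[G]
    rw [exteriorSection_groupProd]
    by_cases h : l.Nodup
    · rw [nodupProd_of_nodup h]
      exact groupProd_mem _ hl
    · rw [nodupProd_of_not_nodup h]
      exact zero_mem _
  exact h (range_pow_le_span _ n hx)

theorem toExterior_groupProd (l : List G) :
    WeakExteriorAlgebra.toExterior (groupProd (WeakExteriorAlgebra.ι k) l) =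
      groupProd (ExteriorAlgebra.ι k) l :=
  map_groupProd _ WeakExteriorAlgebra.toExterior_ι l

theorem groupProd_exterior_of_not_nodup {l : List G} (hl : ¬ l.Nodup) :
    groupProd (ExteriorAlgebra.ι k) l = 0 := by
  obtain ⟨a, l', h⟩ := exists_perm_cons_cons_of_not_nodup hl
  have key : groupProd (ExteriorAlgebra.ι k) (a :: a :: l') = 0 := by
    simp only [groupProd_cons, ← mul_assoc]
    rw [ExteriorAlgebra.ι_sq_zero, zero_mul]
  rw [← toExterior_groupProd] at key ⊢
  rcases groupProd_perm (k := k) h with h | h <;> rw [h]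
  · exact key
  · rw [map_neg, key, neg_zero]

theorem toExterior_nodupProd (l : List G) :
    WeakExteriorAlgebra.toExterior (nodupProd k l) = groupProd (ExteriorAlgebra.ι k) l := by
  by_cases h : l.Nodup
  · rw [nodupProd_of_nodup h, toExterior_groupProd]
  · rw [nodupProd_of_not_nodup h, map_zero, groupProd_exterior_of_not_nodup h]

/-- The boundary of a product is a combination of the products of its sublists. -/
theorem boundary_groupProd_mem (ε : k[G] →ₗ[k] k) (l : List G) :
    WeakExteriorAlgebra.boundary ε (groupProd (WeakExteriorAlgebra.ι k) l) ∈
      Submodule.span k (groupProd (WeakExteriorAlgebra.ι k) '' {l' | l'.Sublist l}) := by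
  induction l with
  | nil => rw [groupProd_nil, WeakExteriorAlgebra.boundary_one]; exact zero_mem _
  | cons g l ih =>
    rw [groupProd_cons, WeakExteriorAlgebra.boundary_ι_mul]
    refine Submodule.sub_mem _ (Submodule.smul_mem _ _
      (Submodule.subset_span ⟨l, List.sublist_cons_self g l, rfl⟩)) ?_
    generalize WeakExteriorAlgebra.boundary ε (groupProd (WeakExteriorAlgebra.ι k) l) = y at ih
    induction ih using Submodule.span_induction with
    | mem y h =>
      obtain ⟨l', hl', rfl⟩ := h
      exact Submodule.subset_span ⟨g :: l', List.Sublist.cons_cons g hl', groupProd_cons _ g l'⟩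
    | zero => simp
    | add x y _ _ hx hy => rw [mul_add]; exact Submodule.add_mem _ hx hy
    | smul r x _ hx => rw [mul_smul_comm]; exact Submodule.smul_mem _ r hx

/-- The boundary of a product of distinct elements is again a combination of such products, on
which the section inverts the projection. -/
theorem exteriorSection_toExterior_boundary (ε : k[G] →ₗ[k] k) {l : List G} (hl : l.Nodup) :
    exteriorSection k G (WeakExteriorAlgebra.toExterior
      (WeakExteriorAlgebra.boundary ε (groupProd (WeakExteriorAlgebra.ι k) l))) =
        WeakExteriorAlgebra.boundary ε (groupProd (WeakExteriorAlgebra.ι k) l) := by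
  have h := boundary_groupProd_mem ε l
  generalize WeakExteriorAlgebra.boundary ε (groupProd (WeakExteriorAlgebra.ι k) l) = y at h ⊢
  induction h using Submodule.span_induction with
  | mem y h =>
    obtain ⟨l', hl', rfl⟩ := h
    rw [toExterior_groupProd, exteriorSection_groupProd, nodupProd_of_nodup (hl'.nodup hl)]
  | zero => simp
  | add x y _ _ hx hy => rw [map_add, map_add, hx, hy]
  | smul r x _ hx => rw [map_smul, map_smul, hx]

end Section

/-! ### The equivariant splitting in degree `n` -/

section Splitting

variable (G : Type u) [Group G]

/-- The product of a list of `n` elements of `G`, as an element of `Λ̃ⁿ(ℤ[G])`. -/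
def weakProd {n : ℕ} (l : List G) (hl : l.length = n) : weakExteriorPower ℤ n ℤ[G] :=
  ⟨groupProd (WeakExteriorAlgebra.ι ℤ) l, groupProd_mem _ hl⟩

/-- The product of a list of `n` elements of `G`, as an element of `Λⁿ(ℤ[G])`. -/
def exteriorProd {n : ℕ} (l : List G) (hl : l.length = n) : ⋀[ℤ]^n ℤ[G] :=
  ⟨groupProd (ExteriorAlgebra.ι ℤ) l, groupProd_mem _ hl⟩

variable {G}

theorem weakPowerRep_weakProd {n : ℕ} (g : G) (l : List G) (hl : l.length = n) :
    weakPowerRep G n g (weakProd G l hl) = weakProd G (l.map (g * ·)) (by simpa using hl) :=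
  Subtype.ext (map_groupProd_map _ g (WeakExteriorAlgebra.map_ι _) l)

theorem powerRep_exteriorProd {n : ℕ} (g : G) (l : List G) (hl : l.length = n) :
    powerRep G n g (exteriorProd G l hl) = exteriorProd G (l.map (g * ·)) (by simpa using hl) :=
  Subtype.ext (map_groupProd_map _ g (ExteriorAlgebra.map_apply_ι _) l)

theorem projection_weakProd {n : ℕ} (l : List G) (hl : l.length = n) :
    projection G n (weakProd G l hl) = exteriorProd G l hl :=
  Subtype.ext (toExterior_groupProd l)

theorem weak_hom_ext {N : Type*} [AddCommGroup N] [Module ℤ N] {n : ℕ}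
    {F F' : weakExteriorPower ℤ n ℤ[G] →ₗ[ℤ] N}
    (h : ∀ (l : List G) (hl : l.length = n), F (weakProd G l hl) = F' (weakProd G l hl)) :
    F = F' :=
  range_pow_hom_ext h

theorem exterior_hom_ext {N : Type*} [AddCommGroup N] [Module ℤ N] {n : ℕ}
    {F F' : ⋀[ℤ]^n ℤ[G] →ₗ[ℤ] N}
    (h : ∀ (l : List G) (hl : l.length = n), F (exteriorProd G l hl) = F' (exteriorProd G l hl)) :
    F = F' :=
  range_pow_hom_ext h

variable (G)

/-- The `G`-equivariant section `Λⁿ(ℤ[G]) → Λ̃ⁿ(ℤ[G])` of the canonical projection. -/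
def sectionMap (n : ℕ) : (powerRep G n).IntertwiningMap (weakPowerRep G n) where
  toLinearMap := (exteriorSection ℤ G).restrict fun _ hx => exteriorSection_mem n hx
  isIntertwining' g := by
    refine exterior_hom_ext fun l hl => ?_
    rw [LinearMap.comp_apply, LinearMap.comp_apply, powerRep_exteriorProd]
    apply Subtype.ext
    change exteriorSection ℤ G (groupProd _ _) =
      WeakExteriorAlgebra.map _ (exteriorSection ℤ G (groupProd _ _))
    rw [exteriorSection_groupProd, exteriorSection_groupProd]
    have hinj : Function.Injective fun x : G => g * x := mul_right_injective g
    by_cases h : l.Nodup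
    · rw [nodupProd_of_nodup h, nodupProd_of_nodup (h.map hinj),
        map_groupProd_map _ g (WeakExteriorAlgebra.map_ι _) l]
    · rw [nodupProd_of_not_nodup h, nodupProd_of_not_nodup (h ∘ (List.nodup_map_iff hinj).1),
        map_zero]

theorem sectionMap_exteriorProd_of_nodup {n : ℕ} {l : List G} (hl : l.length = n) (h : l.Nodup) :
    sectionMap G n (exteriorProd G l hl) = weakProd G l hl :=
  Subtype.ext ((exteriorSection_groupProd l).trans (nodupProd_of_nodup h))

theorem sectionMap_exteriorProd_of_not_nodup {n : ℕ} {l : List G} (hl : l.length = n)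
    (h : ¬ l.Nodup) : sectionMap G n (exteriorProd G l hl) = 0 :=
  Subtype.ext ((exteriorSection_groupProd l).trans (nodupProd_of_not_nodup h))

theorem projection_sectionMap {n : ℕ} (x : ⋀[ℤ]^n ℤ[G]) :
    projection G n (sectionMap G n x) = x := by
  have h : (projection G n).toLinearMap ∘ₗ (sectionMap G n).toLinearMap = LinearMap.id := by
    refine exterior_hom_ext fun l hl => Subtype.ext ?_
    change WeakExteriorAlgebra.toExterior (exteriorSection ℤ G (groupProd _ l)) = groupProd _ l
    rw [exteriorSection_groupProd, toExterior_nodupProd]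
  exact LinearMap.congr_fun h x

/-- The section is a morphism of complexes: on products with a repetition both sides vanish,
because the product is zero in the exterior algebra. -/
theorem sectionMap_differential {n : ℕ} (x : ⋀[ℤ]^(n + 1) ℤ[G]) :
    sectionMap G n (differential G n x) = weakDifferential G n (sectionMap G (n + 1) x) := by
  have h : (sectionMap G n).toLinearMap ∘ₗ (differential G n).toLinearMap =
      (weakDifferential G n).toLinearMap ∘ₗ (sectionMap G (n + 1)).toLinearMap := by
    refine exterior_hom_ext fun l hl => ?_
    change sectionMap G n (differential G n _) = weakDifferential G n (sectionMap G (n + 1) _)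
    by_cases hd : l.Nodup
    · rw [sectionMap_exteriorProd_of_nodup G hl hd, ← projection_weakProd,
        ← projection_weakDifferential]
      exact Subtype.ext (exteriorSection_toExterior_boundary _ hd)
    · rw [sectionMap_exteriorProd_of_not_nodup G hl hd, map_zero]
      have : exteriorProd G l hl = 0 := Subtype.ext (groupProd_exterior_of_not_nodup hd)
      rw [this, map_zero, map_zero]
  exact LinearMap.congr_fun h x

/-- The inclusion of `Δⁿ(ℤ[G])` in `Λ̃ⁿ(ℤ[G])`. -/
def deltaInclusion (n : ℕ) :
    (Delta G n).toRepresentation.IntertwiningMap (weakPowerRep G n) where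
  toLinearMap := (Delta G n).toSubmodule.subtype
  isIntertwining' _ := rfl

/-- The `G`-equivariant projection of `Λ̃ⁿ(ℤ[G])` onto `Δⁿ(ℤ[G])` along the image of the
section. -/
def deltaRetraction (n : ℕ) :
    (weakPowerRep G n).IntertwiningMap (Delta G n).toRepresentation where
  toLinearMap := (LinearMap.id -
      (sectionMap G n).toLinearMap ∘ₗ (projection G n).toLinearMap).codRestrict
    (Delta G n).toSubmodule fun x => by
      change projection G n (x - sectionMap G n (projection G n x)) = 0
      rw [map_sub, projection_sectionMap, sub_self]
  isIntertwining' g := by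
    refine LinearMap.ext fun x => Subtype.ext ?_
    change weakPowerRep G n g x - sectionMap G n (projection G n (weakPowerRep G n g x)) =
      weakPowerRep G n g (x - sectionMap G n (projection G n x))
    rw [map_sub, (projection G n).isIntertwining, (sectionMap G n).isIntertwining]

theorem deltaRetraction_coe {n : ℕ} (x : weakExteriorPower ℤ n ℤ[G]) :
    (deltaRetraction G n x : weakExteriorPower ℤ n ℤ[G]) =
      x - sectionMap G n (projection G n x) := rfl

theorem deltaRetraction_inclusion {n : ℕ} (x : (Delta G n).toSubmodule) :
    deltaRetraction G n x.1 = x := by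
  apply Subtype.ext
  rw [deltaRetraction_coe, show projection G n x.1 = 0 from x.2, map_zero, sub_zero]

theorem deltaRetraction_weakDifferential {n : ℕ} (x : weakExteriorPower ℤ (n + 1) ℤ[G]) :
    deltaRetraction G n (weakDifferential G n x) =
      deltaDifferential G n (deltaRetraction G (n + 1) x) := by
  apply Subtype.ext
  change weakDifferential G n x - sectionMap G n (projection G n (weakDifferential G n x)) =
    weakDifferential G n (x - sectionMap G (n + 1) (projection G (n + 1) x))
  rw [projection_weakDifferential, sectionMap_differential, map_sub]

theorem deltaRetraction_of_nodup {n : ℕ} {l : List G} (hl : l.length = n) (h : l.Nodup) :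
    deltaRetraction G n (weakProd G l hl) = 0 := by
  apply Subtype.ext
  rw [deltaRetraction_coe, projection_weakProd, sectionMap_exteriorProd_of_nodup G hl h, sub_self]
  rfl

theorem deltaRetraction_of_not_nodup {n : ℕ} {l : List G} (hl : l.length = n) (h : ¬ l.Nodup) :
    (deltaRetraction G n (weakProd G l hl) : weakExteriorPower ℤ n ℤ[G]) = weakProd G l hl := by
  rw [deltaRetraction_coe, projection_weakProd, sectionMap_exteriorProd_of_not_nodup G hl h,
    sub_zero]

/-- `Δⁿ(ℤ[G])` has exponent two. -/
theorem deltaRetraction_add_self {n : ℕ} (x : weakExteriorPower ℤ n ℤ[G]) :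
    deltaRetraction G n x + deltaRetraction G n x = 0 := by
  have h : (deltaRetraction G n).toLinearMap + (deltaRetraction G n).toLinearMap = 0 := by
    refine weak_hom_ext fun l hl => ?_
    change deltaRetraction G n _ + deltaRetraction G n _ = 0
    by_cases hd : l.Nodup
    · rw [deltaRetraction_of_nodup G hl hd, add_zero]
    · apply Subtype.ext
      rw [Submodule.coe_add, deltaRetraction_of_not_nodup G hl hd]
      exact Subtype.ext (groupProd_add_self hd)
  exact LinearMap.congr_fun h x

end Splitting

/-! ### Functions of multisets -/

section Multisets

variable {α : Type*} {M : Type*} [AddCommGroup M]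

open Classical in
/-- The unsigned simplicial coboundary of a function of multisets: the sum of the values at the
multisets obtained by omitting one element, counted with multiplicity. -/
def multisetD (c : Multiset α → M) (x : Multiset α) : M := (x.map fun a => c (x.erase a)).sum

theorem multisetD_zero (c : Multiset α → M) : multisetD c 0 = 0 := by simp [multisetD]

theorem multisetD_cons (c : Multiset α → M) (g : α) (y : Multiset α) :
    multisetD c (g ::ₘ y) = c y + multisetD (fun z => c (g ::ₘ z)) y := by
  classical
  simp only [multisetD]
  rw [Multiset.map_cons, Multiset.sum_cons, Multiset.erase_cons_head]
  congr 2
  refine Multiset.map_congr rfl fun a ha => ?_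
  by_cases h : g = a
  · subst h
    rw [Multiset.erase_cons_head, Multiset.cons_erase ha]
  · rw [Multiset.erase_cons_tail _ h]

theorem multisetD_add_self {c : Multiset α → M} (h2 : ∀ x, c x + c x = 0) (x : Multiset α) :
    multisetD c x + multisetD c x = 0 := by
  classical
  simp only [multisetD]
  rw [← Multiset.sum_map_add]
  simp [h2]

open Classical in
/-- In degree at most four the cone construction does not depend on the repeated element: two
different repeated elements `t`, `t'` leave no room for anything else, and the cocycle condition at
`3 t + 3 t'` compares the two values. -/
theorem cone_unique {n : ℕ} (hn : n ≤ 4) {c : Multiset α → M} (h2 : ∀ x, c x + c x = 0)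
    (hc : ∀ x, x.card = n + 2 → ¬ x.Nodup → multisetD c x = 0) {y : Multiset α} (hy : y.card = n)
    {t t' : α} (ht : 2 ≤ y.count t) (ht' : 2 ≤ y.count t') : c (t ::ₘ y) = c (t' ::ₘ y) := by
  by_cases h : t = t'
  · rw [h]
  have hle : (t ::ₘ t ::ₘ t' ::ₘ t' ::ₘ 0 : Multiset α) ≤ y := by
    rw [Multiset.le_iff_count]
    intro a
    simp only [Multiset.count_cons, Multiset.count_zero]
    by_cases h1 : a = t
    · subst h1
      simpa [h] using ht
    · by_cases h3 : a = t'
      · subst h3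
        simpa [h1] using ht'
      · simp [h1, h3]
  have hcard : n = 4 := by
    have := Multiset.card_le_card hle
    simp at this
    omega
  have hyeq : y = t ::ₘ t ::ₘ t' ::ₘ t' ::ₘ 0 :=
    (Multiset.eq_of_le_of_card_le hle (by simp; omega)).symm
  -- Three summands of this coboundary omit a `t` and three a `t'`.
  have key := hc (t ::ₘ t ::ₘ t ::ₘ t' ::ₘ t' ::ₘ t' ::ₘ 0) (by simp; omega) (by simp)
  simp only [multisetD_cons, multisetD_zero, add_zero] at key
  have e : t' ::ₘ y = t ::ₘ t ::ₘ t' ::ₘ t' ::ₘ t' ::ₘ 0 := by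
    rw [hyeq, Multiset.cons_swap t' t, Multiset.cons_swap t' t]
  rw [e, hyeq]
  have hp := h2 (t ::ₘ t ::ₘ t' ::ₘ t' ::ₘ t' ::ₘ 0)
  have hq := h2 (t ::ₘ t ::ₘ t ::ₘ t' ::ₘ t' ::ₘ 0)
  generalize c (t ::ₘ t ::ₘ t' ::ₘ t' ::ₘ t' ::ₘ 0) = p at key hp ⊢
  generalize c (t ::ₘ t ::ₘ t ::ₘ t' ::ₘ t' ::ₘ 0) = q at key hq ⊢
  have e' : q - p = (p + (p + (p + (q + (q + q))))) - (p + p) - (p + p) - (q + q) := by abel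
  rwa [key, hp, hq, sub_zero, sub_zero, sub_zero, sub_eq_zero] at e'

open Classical in
/-- The cone of `c` in degree `n`: at a multiset of `n` elements with a repeated element `t`, its
value is the value of `c` after one more `t` has been added. The element `t` is chosen arbitrarily,
and the value at all other multisets is zero. -/
def cone (c : Multiset α → M) (n : ℕ) (y : Multiset α) : M :=
  if h : y.card = n ∧ ∃ t, 2 ≤ y.count t then c (h.2.choose ::ₘ y) else 0

open Classical in
theorem not_nodup_iff_exists_count {y : Multiset α} : ¬ y.Nodup ↔ ∃ t, 2 ≤ y.count t := by
  simp [Multiset.nodup_iff_count_le_one, Nat.lt_iff_add_one_le]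

theorem cone_add_self {c : Multiset α → M} (h2 : ∀ x, c x + c x = 0) (n : ℕ) (y : Multiset α) :
    cone c n y + cone c n y = 0 := by
  unfold cone
  split_ifs
  · exact h2 _
  · exact add_zero 0

open Classical in
theorem cone_eq {n : ℕ} (hn : n ≤ 4) {c : Multiset α → M} (h2 : ∀ x, c x + c x = 0)
    (hc : ∀ x, x.card = n + 2 → ¬ x.Nodup → multisetD c x = 0) {y : Multiset α} (hy : y.card = n)
    {t : α} (ht : 2 ≤ y.count t) : cone c n y = c (t ::ₘ y) := by
  have h : y.card = n ∧ ∃ t, 2 ≤ y.count t := ⟨hy, t, ht⟩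
  rw [cone, dif_pos h]
  exact cone_unique hn h2 hc hy h.2.choose_spec ht

theorem cone_map {n : ℕ} (hn : n ≤ 4) {c : Multiset α → M} (h2 : ∀ x, c x + c x = 0)
    (hc : ∀ x, x.card = n + 2 → ¬ x.Nodup → multisetD c x = 0) {s : α → α}
    (hs : Function.Injective s) {T : M → M} (hT : T 0 = 0)
    (hcs : ∀ x, c (x.map s) = T (c x)) (y : Multiset α) :
    cone c n (y.map s) = T (cone c n y) := by
  classical
  by_cases h : y.card = n ∧ ∃ t, 2 ≤ y.count t
  · obtain ⟨hy, t, ht⟩ := h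
    rw [cone_eq hn h2 hc hy ht, cone_eq hn h2 hc (t := s t) (by simpa using hy)
      (by rwa [Multiset.count_map_eq_count' _ _ hs]), ← hcs, Multiset.map_cons]
  · have h' : ¬ ((y.map s).card = n ∧ ∃ t, 2 ≤ (y.map s).count t) := by
      rw [← not_nodup_iff_exists_count, Multiset.nodup_map_iff_of_injective hs, Multiset.card_map,
        not_nodup_iff_exists_count]
      exact h
    rw [cone, cone, dif_neg h, dif_neg h', hT]

/-- The coboundary of the cone of a cocycle `c` is `c`: the cocycle condition at `t + x` expresses
`c x` through the values of `c` at `t + (x - a)`. The terms with `a = t` for which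
`t` is not repeated in `x - a` occur twice, and cancel. -/
theorem multisetD_cone {n : ℕ} (hn : n ≤ 4) {c : Multiset α → M} (h2 : ∀ x, c x + c x = 0)
    (hc : ∀ x, x.card = n + 2 → ¬ x.Nodup → multisetD c x = 0) {x : Multiset α}
    (hx : x.card = n + 1) (hd : ¬ x.Nodup) : multisetD (cone c n) x = c x := by
  classical
  obtain ⟨t, ht⟩ := not_nodup_iff_exists_count.1 hd
  have key := hc (t ::ₘ x) (by simp [hx]) fun h => hd (Multiset.nodup_cons.1 h).2
  rw [multisetD_cons] at key
  have hcx : c x = multisetD (fun z => c (t ::ₘ z)) x := by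
    rw [eq_neg_of_add_eq_zero_left key]
    exact (eq_neg_of_add_eq_zero_left (multisetD_add_self (fun z => h2 (t ::ₘ z)) x)).symm
  rw [hcx]
  have hcard : ∀ a ∈ x, (x.erase a).card = n := fun a ha => by
    rw [Multiset.card_erase_of_mem ha, hx]; rfl
  have hne : ∀ a ∈ x, a ≠ t → cone c n (x.erase a) = c (t ::ₘ x.erase a) := fun a ha h =>
    cone_eq hn h2 hc (hcard a ha) (by rwa [Multiset.count_erase_of_ne h.symm])
  simp only [multisetD]
  by_cases h3 : 3 ≤ x.count t
  · refine congrArg _ (Multiset.map_congr rfl fun a ha => ?_)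
    by_cases h : a = t
    · subst h
      exact cone_eq hn h2 hc (hcard a ha) (by rw [Multiset.count_erase_self]; omega)
    · exact hne a ha h
  · have h0 : t ∈ x := Multiset.count_pos.1 (by omega)
    have h1 : t ∈ x.erase t := Multiset.count_pos.1 (by rw [Multiset.count_erase_self]; omega)
    set z := (x.erase t).erase t with hz
    have hxz : x = t ::ₘ t ::ₘ z := by rw [hz, Multiset.cons_erase h1, Multiset.cons_erase h0]
    have htz : t ∉ z := by
      rw [← Multiset.count_eq_zero, hz, Multiset.count_erase_self, Multiset.count_erase_self]
      omega
    have hsum : ∀ F : α → M, F t + F t = 0 → (x.map F).sum = (z.map F).sum := fun F hF => by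
      rw [hxz, Multiset.map_cons, Multiset.map_cons, Multiset.sum_cons, Multiset.sum_cons,
        ← add_assoc, hF, zero_add]
    rw [hsum _ (cone_add_self h2 n _), hsum _ (h2 _)]
    refine congrArg _ (Multiset.map_congr rfl fun a ha => ?_)
    refine hne a ?_ (ne_of_mem_of_not_mem ha htz)
    rw [hxz]
    exact Multiset.mem_cons_of_mem (Multiset.mem_cons_of_mem ha)

end Multisets

/-! ### Vanishing of `δ`-cohomology -/

section DeltaExact

theorem multisetFun_mem {G : Type u} {M : Type v} [AddCommGroup M] {c : Multiset G → M}
    (h2 : ∀ x, c x + c x = 0) :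
    (fun l : List G => c l) ∈ skewListFun ℤ G M := fun s a b l => by
  have : ((s ++ a :: b :: l : List G) : Multiset G) = (s ++ b :: a :: l : List G) :=
    Multiset.coe_eq_coe.2 ((List.Perm.swap b a l).append_left s)
  change c _ + c _ = 0
  rw [this, h2]

variable {G : Type u} [Group G] {M : Type v} [AddCommGroup M]

/-- The linear map `Λ̃(ℤ[G]) → M` attached to a function of multisets with values of order two. -/
def multisetLift (c : Multiset G → M) (h2 : ∀ x, c x + c x = 0) :
    WeakExteriorAlgebra ℤ ℤ[G] →ₗ[ℤ] M :=
  weakLift (fun l => c l) (multisetFun_mem h2)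

theorem multisetLift_groupProd (c : Multiset G → M) (h2 : ∀ x, c x + c x = 0) (l : List G) :
    multisetLift c h2 (groupProd (WeakExteriorAlgebra.ι ℤ) l) = c l :=
  weakLift_groupProd _ _ l

/-- Values of order two make the signs of the boundary irrelevant. -/
theorem multisetLift_boundary (c : Multiset G → M) (h2 : ∀ x, c x + c x = 0) (l : List G) :
    multisetLift c h2 (WeakExteriorAlgebra.boundary (augmentation G)
      (groupProd (WeakExteriorAlgebra.ι ℤ) l)) = multisetD c l := by
  induction l generalizing c with
  | nil =>
    rw [groupProd_nil, WeakExteriorAlgebra.boundary_one, map_zero]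
    exact (multisetD_zero c).symm
  | cons g l ih =>
    have h2' : ∀ x, (fun z => c (g ::ₘ z)) x + (fun z => c (g ::ₘ z)) x = 0 := fun x => h2 _
    have hmul : ∀ y ∈ Submodule.span ℤ
        (groupProd (WeakExteriorAlgebra.ι ℤ) '' {l' : List G | l'.Sublist l}),
        multisetLift c h2 (WeakExteriorAlgebra.ι ℤ (MonoidAlgebra.of ℤ G g) * y) =
          multisetLift _ h2' y := by
      intro y hy
      induction hy using Submodule.span_induction with
      | mem y h =>
        obtain ⟨l', -, rfl⟩ := h
        rw [← groupProd_cons, multisetLift_groupProd, multisetLift_groupProd]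
        rfl
      | zero => simp
      | add x y _ _ hx hy => rw [mul_add, map_add, map_add, hx, hy]
      | smul r x _ hx => rw [mul_smul_comm, map_smul, map_smul, hx]
    rw [groupProd_cons, WeakExteriorAlgebra.boundary_ι_mul, augmentation_of, one_smul, map_sub,
      multisetLift_groupProd, hmul _ (boundary_groupProd_mem _ l), ih _ h2', ← Multiset.cons_coe,
      multisetD_cons, sub_eq_add_neg]
    exact congrArg _ (eq_neg_of_add_eq_zero_left (multisetD_add_self h2' l)).symm

variable [DistribMulAction G M]

/-- The `G`-map `Λ̃ⁿ(ℤ[G]) → M` attached to an equivariant function of multisets with values of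
order two. -/
def multisetHom (n : ℕ) (c : Multiset G → M) (h2 : ∀ x, c x + c x = 0)
    (hc : ∀ (g : G) x, c (x.map (g * ·)) = g • c x) :
    (weakPowerRep G n).IntertwiningMap (Representation.ofDistribMulAction ℤ G M) where
  toLinearMap := multisetLift c h2 ∘ₗ (weakExteriorPower ℤ n ℤ[G]).subtype
  isIntertwining' g := by
    refine weak_hom_ext fun l hl => ?_
    rw [LinearMap.comp_apply, weakPowerRep_weakProd]
    refine (multisetLift_groupProd c h2 _).trans ?_
    rw [← Multiset.map_coe, hc]
    exact congrArg (g • ·) (multisetLift_groupProd c h2 l).symm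

/-- The function of multisets attached to a `G`-map `f : Δⁿ(ℤ[G]) → M`: its value at a multiset of
`n` elements is the value of `f` at the product of these elements in some order if there is a
repetition, and zero otherwise. -/
def toMultisetFun {n : ℕ} (f : (Delta G n).toRepresentation.IntertwiningMap
    (Representation.ofDistribMulAction ℤ G M)) (x : Multiset G) : M :=
  if h : x.card = n then f (deltaRetraction G n (weakProd G x.toList (by simpa using h))) else 0

variable {n : ℕ} (f : (Delta G n).toRepresentation.IntertwiningMap
    (Representation.ofDistribMulAction ℤ G M))

theorem map_deltaRetraction_add_self (x : weakExteriorPower ℤ n ℤ[G]) :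
    f (deltaRetraction G n x) + f (deltaRetraction G n x) = 0 := by
  rw [← map_add, deltaRetraction_add_self, map_zero]

theorem toMultisetFun_add_self (x : Multiset G) : toMultisetFun f x + toMultisetFun f x = 0 := by
  unfold toMultisetFun
  split_ifs
  · exact map_deltaRetraction_add_self f _
  · exact add_zero 0

theorem toMultisetFun_coe {l : List G} (hl : l.length = n) :
    toMultisetFun f l = f (deltaRetraction G n (weakProd G l hl)) := by
  rw [toMultisetFun, dif_pos (by simpa using hl)]
  have hp : (l : Multiset G).toList.Perm l := Multiset.coe_eq_coe.1 (Multiset.coe_toList _)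
  have hl' : (l : Multiset G).toList.length = n := by simpa using hl
  rcases groupProd_perm (k := ℤ) hp with h | h
  · have : weakProd G _ hl' = weakProd G l hl := Subtype.ext h
    rw [this]
  · have : weakProd G _ hl' = -weakProd G l hl := Subtype.ext h
    rw [this, map_neg, map_neg]
    exact (eq_neg_of_add_eq_zero_left (map_deltaRetraction_add_self f _)).symm

theorem toMultisetFun_map (g : G) (x : Multiset G) :
    toMultisetFun f (x.map (g * ·)) = g • toMultisetFun f x := by
  induction x using Quotient.inductionOn with | h l => ?_
  by_cases hl : l.length = n
  · change toMultisetFun f (Multiset.map _ (l : Multiset G)) = g • toMultisetFun f (l : Multiset G)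
    rw [Multiset.map_coe, toMultisetFun_coe f hl, toMultisetFun_coe f (by simpa using hl),
      ← weakPowerRep_weakProd, (deltaRetraction G n).isIntertwining, f.isIntertwining]
    rfl
  · have h : ∀ l' : List G, l'.length ≠ n → toMultisetFun f l' = 0 := fun l' h => dif_neg h
    exact (h (l.map (g * ·)) (by simpa using hl)).trans
      ((smul_zero g).symm.trans (congrArg (g • ·) (h l hl).symm))

theorem multisetLift_toMultisetFun (x : weakExteriorPower ℤ n ℤ[G]) :
    multisetLift (toMultisetFun f) (toMultisetFun_add_self f) x = f (deltaRetraction G n x) := by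
  have h : multisetLift (toMultisetFun f) (toMultisetFun_add_self f) ∘ₗ
      (weakExteriorPower ℤ n ℤ[G]).subtype = f.toLinearMap ∘ₗ (deltaRetraction G n).toLinearMap :=
    weak_hom_ext fun l hl => (multisetLift_groupProd _ (toMultisetFun_add_self f) l).trans
      (toMultisetFun_coe f hl)
  exact LinearMap.congr_fun h x

/-- `G`-maps on `Δⁿ(ℤ[G])` are determined by their values on products with a repetition. -/
theorem delta_hom_ext {f f' : (Delta G n).toRepresentation.IntertwiningMap
    (Representation.ofDistribMulAction ℤ G M)}
    (h : ∀ (l : List G) (hl : l.length = n), ¬ l.Nodup →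
      f (deltaRetraction G n (weakProd G l hl)) = f' (deltaRetraction G n (weakProd G l hl))) :
    f = f' := by
  have e : f.toLinearMap ∘ₗ (deltaRetraction G n).toLinearMap =
      f'.toLinearMap ∘ₗ (deltaRetraction G n).toLinearMap := by
    refine weak_hom_ext fun l hl => ?_
    by_cases hd : l.Nodup
    · change f (deltaRetraction G n _) = f' (deltaRetraction G n _)
      rw [deltaRetraction_of_nodup G hl hd, map_zero, map_zero]
    · exact h l hl hd
  refine Representation.IntertwiningMap.ext (LinearMap.ext fun x => ?_)
  have := LinearMap.congr_fun e x.1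
  change f (deltaRetraction G n x.1) = f' (deltaRetraction G n x.1) at this
  rw [deltaRetraction_inclusion] at this
  exact this

/-- A `δ`-cocycle of degree at most four is a coboundary. -/
theorem exists_comp_deltaDifferential (hn : n ≤ 4)
    (f : (Delta G (n + 1)).toRepresentation.IntertwiningMap
      (Representation.ofDistribMulAction ℤ G M))
    (hf : f.comp (deltaDifferential G (n + 1)) = 0) :
    ∃ f' : (Delta G n).toRepresentation.IntertwiningMap
      (Representation.ofDistribMulAction ℤ G M), f'.comp (deltaDifferential G n) = f := by
  have h2 := toMultisetFun_add_self f
  have hc : ∀ x : Multiset G, x.card = n + 2 → ¬ x.Nodup → multisetD (toMultisetFun f) x = 0 := by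
    intro x hx _
    induction x using Quotient.inductionOn with | h l => ?_
    have hl : l.length = n + 2 := hx
    refine (multisetLift_boundary _ h2 l).symm.trans ?_
    refine (multisetLift_toMultisetFun f (weakDifferential G (n + 1) (weakProd G l hl))).trans ?_
    rw [deltaRetraction_weakDifferential]
    exact congrArg (fun F => F (deltaRetraction G (n + 2) (weakProd G l hl))) hf
  have h2' := cone_add_self h2 n
  refine ⟨(multisetHom n (cone (toMultisetFun f) n) h2' fun g y =>
    cone_map hn h2 hc (mul_right_injective g) (smul_zero g) (toMultisetFun_map f g) y).comp
    (deltaInclusion G n), delta_hom_ext fun l hl hd => ?_⟩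
  have e : (weakDifferential G n (deltaRetraction G (n + 1) (weakProd G l hl)).1).1 =
      WeakExteriorAlgebra.boundary (augmentation G) (groupProd (WeakExteriorAlgebra.ι ℤ) l) := by
    rw [deltaRetraction_of_not_nodup G hl hd]; rfl
  change multisetLift _ h2' (weakDifferential G n (deltaRetraction G (n + 1) _).1).1 = _
  rw [e, multisetLift_boundary, multisetD_cone hn h2 hc (x := (l : Multiset G)) hl hd,
    toMultisetFun_coe f hl]

theorem delta_one_hom_eq_zero (f : (Delta G 1).toRepresentation.IntertwiningMap
    (Representation.ofDistribMulAction ℤ G M)) : f = 0 :=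
  delta_hom_ext fun l hl hd => by
    obtain ⟨a, rfl⟩ := List.length_eq_one_iff.1 hl
    exact absurd (List.nodup_singleton a) hd

variable (G M)

theorem isZero_deltaCohomology {i : ℕ} (hi : i ≤ 4) : Limits.IsZero (deltaCohomology G M i) := by
  rw [← HomologicalComplex.exactAt_iff_isZero_homology]
  rcases i with _ | n
  · rw [HomologicalComplex.exactAt_iff' _ 0 0 1 (by simp) (by simp), ShortComplex.ab_exact_iff]
    intro f _
    exact ⟨0, (map_zero _).trans (delta_one_hom_eq_zero (G := G) (M := M) f).symm⟩
  · rw [HomologicalComplex.exactAt_iff' _ n (n + 1) (n + 2) (by simp) (by simp),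
      ShortComplex.ab_exact_iff]
    intro f hf
    change (deltaComplex G M).d (n + 1) (n + 2) f = 0 at hf
    rw [deltaComplex_d] at hf
    obtain ⟨f', hf'⟩ := exists_comp_deltaDifferential hi f hf
    refine ⟨f', ?_⟩
    change (deltaComplex G M).d n (n + 1) f' = f
    rw [deltaComplex_d]
    exact hf'

end DeltaExact

/-! ### The splitting of the cochain complexes -/

section HomComplexMap

variable {G : Type u} [Group G]

/-- The morphism `Hom_G(V', M) → Hom_G(V, M)` of cochain complexes induced by a morphism `V → V'`
of complexes of `G`-modules. -/
def homComplexMap {V V' : ℕ → Type u} [∀ n, AddCommGroup (V n)] [∀ n, AddCommGroup (V' n)]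
    {ρ : ∀ n, Representation ℤ G (V n)} {d : ∀ n, (ρ (n + 1)).IntertwiningMap (ρ n)}
    {hd : ∀ n x, d n (d (n + 1) x) = 0}
    {ρ' : ∀ n, Representation ℤ G (V' n)} {d' : ∀ n, (ρ' (n + 1)).IntertwiningMap (ρ' n)}
    {hd' : ∀ n x, d' n (d' (n + 1) x) = 0}
    (T : ∀ n, (ρ n).IntertwiningMap (ρ' n)) (hT : ∀ n x, T n (d n x) = d' n (T (n + 1) x))
    (M : Type v) [AddCommGroup M] [DistribMulAction G M] :
    homComplex ρ' d' hd' M ⟶ homComplex ρ d hd M :=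
  CochainComplex.ofHom (fun n => AddCommGrpCat.ofHom (precomp (T n) M)) fun n => by
    rw [homComplex_d, homComplex_d]
    refine AddCommGrpCat.hom_ext (AddMonoidHom.ext
      fun f : (ρ' n).IntertwiningMap (Representation.ofDistribMulAction ℤ G M) => ?_)
    refine Representation.IntertwiningMap.ext (LinearMap.ext fun x => ?_)
    exact congrArg f (hT n x)

variable (G) (M : Type v) [AddCommGroup M] [DistribMulAction G M]

/-- The cochain complex `Hom_G(Λ̃^{*+1}(ℤ[G]), M)`. -/
def weakComplex : CochainComplex AddCommGrpCat.{max u v} ℕ :=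
  homComplex (fun n => weakPowerRep G (n + 1)) (fun n => weakDifferential G (n + 1))
    (fun n x => weakDifferential_comp G (n + 1) x) M

theorem weakComplex_d (n : ℕ) : (weakComplex G M).d n (n + 1) =
    AddCommGrpCat.ofHom (precomp (weakDifferential G (n + 1)) M) :=
  homComplex_d (fun n => weakPowerRep G (n + 1)) (fun n => weakDifferential G (n + 1))
    (fun n x => weakDifferential_comp G (n + 1) x) M n

/-- The morphism of complexes induced by the projection `Λ̃ → Λ`. -/
def projectionStar : lambdaComplex G M ⟶ weakComplex G M :=
  homComplexMap (fun n => projection G (n + 1))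
    (fun n x => projection_weakDifferential G (n + 1) x) M

/-- The morphism of complexes induced by the section `Λ → Λ̃`. -/
def sectionStar : weakComplex G M ⟶ lambdaComplex G M :=
  homComplexMap (fun n => sectionMap G (n + 1))
    (fun n x => sectionMap_differential G (n := n + 1) x) M

/-- The morphism of complexes induced by the inclusion `Δ → Λ̃`. -/
def inclusionStar : weakComplex G M ⟶ deltaComplex G M :=
  (homComplexMap (V := fun n => (Delta G (n + 1)).toSubmodule)
    (ρ := fun n => (Delta G (n + 1)).toRepresentation)
    (d := fun n => deltaDifferential G (n + 1))
    (hd := fun n x => deltaDifferential_comp G (n + 1) x)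
    (ρ' := fun n => weakPowerRep G (n + 1)) (d' := fun n => weakDifferential G (n + 1))
    (hd' := fun n x => weakDifferential_comp G (n + 1) x)
    (fun n => deltaInclusion G (n + 1)) (fun _ _ => rfl) M :)

/-- The morphism of complexes induced by the retraction `Λ̃ → Δ`. -/
def retractionStar : deltaComplex G M ⟶ weakComplex G M :=
  (homComplexMap (ρ := fun n => weakPowerRep G (n + 1))
    (d := fun n => weakDifferential G (n + 1))
    (hd := fun n x => weakDifferential_comp G (n + 1) x)
    (V' := fun n => (Delta G (n + 1)).toSubmodule)
    (ρ' := fun n => (Delta G (n + 1)).toRepresentation)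
    (d' := fun n => deltaDifferential G (n + 1))
    (hd' := fun n x => deltaDifferential_comp G (n + 1) x)
    (fun n => deltaRetraction G (n + 1))
    (fun n x => deltaRetraction_weakDifferential G (n := n + 1) x) M :)

theorem projectionStar_sectionStar : projectionStar G M ≫ sectionStar G M = 𝟙 _ := by
  refine HomologicalComplex.hom_ext _ _ fun n => ?_
  refine AddCommGrpCat.hom_ext (AddMonoidHom.ext
    fun f : (powerRep G (n + 1)).IntertwiningMap (Representation.ofDistribMulAction ℤ G M) => ?_)
  refine Representation.IntertwiningMap.ext (LinearMap.ext fun x => ?_)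
  exact congrArg f (projection_sectionMap G x)

theorem sectionStar_add_inclusionStar :
    sectionStar G M ≫ projectionStar G M + inclusionStar G M ≫ retractionStar G M = 𝟙 _ := by
  refine HomologicalComplex.hom_ext _ _ fun n => ?_
  refine AddCommGrpCat.hom_ext (AddMonoidHom.ext
    fun f : (weakPowerRep G (n + 1)).IntertwiningMap
      (Representation.ofDistribMulAction ℤ G M) => ?_)
  refine Representation.IntertwiningMap.ext (LinearMap.ext fun x => ?_)
  rw [HomologicalComplex.add_f_apply]
  change f (sectionMap G (n + 1) (projection G (n + 1) x)) + f (deltaRetraction G (n + 1) x).1 = f x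
  rw [← map_add, deltaRetraction_coe, add_sub_cancel]

/-- The complementary summand contributes nothing to homology where `δ`-cohomology vanishes. -/
theorem isIso_homologyMap_projectionStar {i : ℕ} (hi : i ≤ 4) :
    IsIso (HomologicalComplex.homologyMap (projectionStar G M) i) := by
  refine ⟨HomologicalComplex.homologyMap (sectionStar G M) i, ?_, ?_⟩
  · rw [← HomologicalComplex.homologyMap_comp, projectionStar_sectionStar,
      HomologicalComplex.homologyMap_id]
  · have h := congrArg (fun f => HomologicalComplex.homologyMap f i)
      (sectionStar_add_inclusionStar G M)
    simp only [HomologicalComplex.homologyMap_add, HomologicalComplex.homologyMap_comp,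
      HomologicalComplex.homologyMap_id] at h
    rw [(isZero_deltaCohomology G M hi).eq_zero_of_tgt
      (HomologicalComplex.homologyMap (inclusionStar G M) i), Limits.zero_comp, add_zero] at h
    exact h

end HomComplexMap

/-! ### Lists and tuples -/

section Tuples

variable {α : Type*} {n : ℕ}

/-- The entries of a list of length `n`, as a function on `Fin n`. -/
def listTuple (l : List α) (hl : l.length = n) : Fin n → α := fun i => l.get (i.cast hl.symm)

theorem ofFn_listTuple (l : List α) (hl : l.length = n) : List.ofFn (listTuple l hl) = l := by
  subst hl
  exact List.ofFn_get l

theorem listTuple_ofFn (x : Fin n → α) :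
    listTuple (List.ofFn x) (List.length_ofFn) = x := by
  funext i
  simp [listTuple]

theorem listTuple_map {β : Type*} (f : α → β) (l : List α) (hl : l.length = n) :
    listTuple (l.map f) (by simpa using hl) = fun i => f (listTuple l hl i) := by
  funext i
  simp [listTuple]

/-- Exchanging two neighbouring entries of a list precomposes its tuple with an adjacent
transposition. -/
theorem listTuple_swap {s t : List α} {a b : α} (h : (s ++ a :: b :: t).length = n + 1)
    (h' : (s ++ b :: a :: t).length = n + 1) (i : Fin n) (hi : s.length = i) :
    listTuple (s ++ b :: a :: t) h' =
      fun k => listTuple (s ++ a :: b :: t) h (Equiv.swap i.castSucc i.succ k) := by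
  funext k
  simp only [listTuple, List.get_eq_getElem, Fin.val_cast]
  by_cases h1 : k = i.castSucc
  · subst h1
    simp [← hi]
  by_cases h2 : k = i.succ
  · subst h2
    simp [← hi]
  rw [Equiv.swap_apply_of_ne_of_ne h1 h2]
  have h1' : (k : ℕ) ≠ s.length := fun e => h1 (Fin.ext (by simp [e, hi]))
  have h2' : (k : ℕ) ≠ s.length + 1 := fun e => h2 (Fin.ext (by simp [e, hi]))
  simp only [List.getElem_append]
  split_ifs with h3
  · rfl
  · obtain ⟨m, hm⟩ : ∃ m, (k : ℕ) - s.length = m + 2 := ⟨(k : ℕ) - s.length - 2, by omega⟩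
    simp [hm]

theorem exists_ofFn_swap (x : Fin (n + 1) → α) (i : Fin n) : ∃ s a b t,
    List.ofFn x = s ++ a :: b :: t ∧
      List.ofFn (fun k => x (Equiv.swap i.castSucc i.succ k)) = s ++ b :: a :: t := by
  obtain ⟨l, hl⟩ : ∃ l, l = List.ofFn x := ⟨_, rfl⟩
  have hlen : l.length = n + 1 := by rw [hl, List.length_ofFn]
  have hdl : (l.drop i).length = n + 1 - i := by rw [List.length_drop, hlen]
  have hi := i.isLt
  rcases hd : l.drop i with _ | ⟨a, _ | ⟨b, t⟩⟩
  · simp [hd] at hdl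
    omega
  · simp [hd] at hdl
    omega
  have e : l.take i ++ a :: b :: t = l := by rw [← hd, List.take_append_drop]
  have h : (l.take i ++ a :: b :: t).length = n + 1 := by rw [e, hlen]
  have h' : (l.take i ++ b :: a :: t).length = n + 1 := by simpa using h
  refine ⟨_, _, _, _, hl.symm.trans e.symm, ?_⟩
  rw [← ofFn_listTuple _ h', listTuple_swap h h' i (by simp [hlen]; omega)]
  have : listTuple _ h = x := by
    rw [← listTuple_ofFn x]
    congr 1
    exact e.trans hl
  rw [this]

end Tuples

/-! ### Symmetric cochains as maps on weak exterior powers -/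

section WeakCochains

variable {G : Type u} [Group G] {M : Type v} [AddCommGroup M] [DistribMulAction G M]

/-- The product of an `n`-tuple of elements of `G`, as an element of `Λ̃ⁿ(ℤ[G])`. -/
def tupleProd {n : ℕ} (x : Fin n → G) : weakExteriorPower ℤ n ℤ[G] :=
  weakProd G (List.ofFn x) List.length_ofFn

theorem tupleProd_coe {n : ℕ} (x : Fin n → G) : (tupleProd x : WeakExteriorAlgebra ℤ ℤ[G]) =
    (List.ofFn fun i => WeakExteriorAlgebra.ι ℤ (MonoidAlgebra.of ℤ G (x i))).prod := by
  change groupProd _ _ = _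
  rw [groupProd, List.map_ofFn]
  rfl

theorem tupleProd_listTuple {n : ℕ} (l : List G) (hl : l.length = n) :
    tupleProd (listTuple l hl) = weakProd G l hl :=
  Subtype.ext (congrArg (groupProd _) (ofFn_listTuple l hl))

theorem weakPowerRep_tupleProd {n : ℕ} (g : G) (x : Fin n → G) :
    weakPowerRep G n g (tupleProd x) = tupleProd fun i => g * x i := by
  rw [tupleProd, weakPowerRep_weakProd]
  refine Subtype.ext (congrArg (groupProd _) ?_)
  rw [List.map_ofFn]
  rfl

theorem projection_tupleProd {n : ℕ} (x : Fin n → G) : projection G n (tupleProd x) =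
    exteriorPower.ιMulti ℤ n fun i => MonoidAlgebra.of ℤ G (x i) := by
  rw [tupleProd, projection_weakProd]
  apply Subtype.ext
  rw [exteriorPower.ιMulti_apply_coe, ExteriorAlgebra.ιMulti_apply]
  change groupProd _ _ = _
  rw [groupProd, List.map_ofFn]
  rfl

theorem weakDifferential_tupleProd {n : ℕ} (x : Fin (n + 1) → G) :
    weakDifferential G n (tupleProd x) =
      ∑ i : Fin (n + 1), (-1 : ℤ) ^ (i : ℕ) • tupleProd fun j => x (i.succAbove j) := by
  apply Subtype.ext
  have h := WeakExteriorAlgebra.boundary_prod (augmentation G) n fun i => MonoidAlgebra.of ℤ G (x i)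
  simp only [augmentation_of, mul_one, ← tupleProd_coe] at h
  rw [AddSubmonoidClass.coe_finsetSum]
  exact h

theorem tupleProd_swap {n : ℕ} (x : Fin (n + 1) → G) (i : Fin n) :
    tupleProd (fun k => x (Equiv.swap i.castSucc i.succ k)) = -tupleProd x := by
  obtain ⟨s, a, b, t, h, h'⟩ := exists_ofFn_swap x i
  apply Subtype.ext
  change groupProd _ _ = -groupProd _ _
  rw [h, h', groupProd_append, groupProd_append, ← mul_neg]
  refine congrArg _ ?_
  simp only [groupProd_cons, ← mul_assoc]
  rw [eq_neg_of_add_eq_zero_left (WeakExteriorAlgebra.ι_skew (k := ℤ)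
    (MonoidAlgebra.of ℤ G b) (MonoidAlgebra.of ℤ G a)), neg_mul]

/-- The inhomogeneous cochain `(g₁, …, gₙ) ↦ F(1 ∧̃ g₁ ∧̃ g₁ g₂ ∧̃ ⋯ ∧̃ g₁ ⋯ gₙ)` attached to a
`G`-map `F : Λ̃ⁿ⁺¹(ℤ[G]) → M`. -/
def weakCochain {n : ℕ} (F : (weakPowerRep G (n + 1)).IntertwiningMap
    (Representation.ofDistribMulAction ℤ G M)) (g : Fin n → G) : M :=
  F (tupleProd (Fin.partialProd g))

variable {n : ℕ} (F : (weakPowerRep G (n + 1)).IntertwiningMap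
    (Representation.ofDistribMulAction ℤ G M))

theorem homogenize_weakCochain (x : Fin (n + 1) → G) :
    homogenize (weakCochain F) x = F (tupleProd x) := by
  have h := F.isIntertwining _ _ (x 0)
    (tupleProd (Fin.partialProd (fun i => (x i.castSucc)⁻¹ * x i.succ)))
  rw [weakPowerRep_tupleProd, Representation.ofDistribMulAction_apply_apply] at h
  refine h.symm.trans ?_
  have hx := Fin.partialProd_left_inv x
  conv_rhs => rw [← hx]
  rfl

theorem weakCochain_mem : weakCochain F ∈ symmetricCochains G M n := by
  rw [mem_symmetricCochains_iff]
  intro i x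
  rw [homogenize_weakCochain, homogenize_weakCochain, tupleProd_swap, map_neg]

theorem cochainD_weakCochain :
    cochainD n (weakCochain F) = weakCochain (F.comp (weakDifferential G (n + 1))) := by
  apply homogenize_injective
  intro x
  rw [homogenize_cochainD, homogenize_weakCochain, Representation.IntertwiningMap.comp_apply,
    weakDifferential_tupleProd, map_sum]
  refine Finset.sum_congr rfl fun i _ => ?_
  rw [homogenize_weakCochain, map_zsmul]

theorem weakCochain_injective : Function.Injective (weakCochain (G := G) (M := M) (n := n)) := by
  intro F F' h
  refine Representation.IntertwiningMap.ext (weak_hom_ext fun l hl => ?_)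
  rw [← tupleProd_listTuple]
  have := congrArg (fun φ => homogenize φ (listTuple l hl)) h
  simp only [homogenize_weakCochain] at this
  exact this

/-- Every symmetric cochain comes from `Λ̃`: its homogeneous form is a skew function of tuples. -/
theorem exists_weakCochain_eq {φ : (Fin n → G) → M} (hφ : φ ∈ symmetricCochains G M n) :
    ∃ F : (weakPowerRep G (n + 1)).IntertwiningMap (Representation.ofDistribMulAction ℤ G M),
      weakCochain F = φ := by
  -- The value off length `n + 1` plays no role; zero keeps the function skew.
  let β : List G → M := fun l =>
    if h : l.length = n + 1 then homogenize φ (listTuple l h) else 0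
  have hβ : β ∈ skewListFun ℤ G M := by
    intro s a b t
    by_cases h : (s ++ a :: b :: t).length = n + 1
    · have h' : (s ++ b :: a :: t).length = n + 1 := by simpa using h
      have hs : s.length < n := by simp at h; omega
      simp only [β]
      rw [dif_pos h, dif_pos h', listTuple_swap h h' ⟨s.length, hs⟩ rfl,
        (mem_symmetricCochains_iff φ).1 hφ, add_neg_cancel]
    · have h' : ¬ (s ++ b :: a :: t).length = n + 1 := by simpa using h
      simp only [β]
      rw [dif_neg h, dif_neg h', add_zero]
  have key : ∀ (l : List G) (hl : l.length = n + 1),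
      weakLift β hβ (weakProd G l hl : WeakExteriorAlgebra ℤ ℤ[G]) =
        homogenize φ (listTuple l hl) :=
    fun l hl => (weakLift_groupProd β hβ l).trans (dif_pos hl)
  refine ⟨⟨weakLift β hβ ∘ₗ (weakExteriorPower ℤ (n + 1) ℤ[G]).subtype, fun g => ?_⟩, ?_⟩
  · refine weak_hom_ext fun l hl => ?_
    rw [LinearMap.comp_apply, weakPowerRep_weakProd]
    refine (key _ (by simpa using hl)).trans ?_
    rw [listTuple_map _ l hl, homogenize_smul]
    exact congrArg (g • ·) (key l hl).symm
  · funext g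
    refine (key _ List.length_ofFn).trans ?_
    rw [listTuple_ofFn, homogenize_partialProd]

variable (G M)

/-- The morphism `Hom_G(Λ̃^{*+1}(ℤ[G]), M) → CS*(G, M)` of complexes. -/
def weakGamma : weakComplex G M ⟶ symmetricComplex G M :=
  CochainComplex.ofHom
    (fun n => AddCommGrpCat.ofHom (AddMonoidHom.mk'
      (fun F => (⟨weakCochain F, weakCochain_mem F⟩ : symmetricCochains G M n))
      (fun _ _ => rfl)))
    (fun n => by
      rw [symmetricComplex_d, weakComplex_d]
      refine AddCommGrpCat.hom_ext (AddMonoidHom.ext fun f => Subtype.ext ?_)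
      exact cochainD_weakCochain f)

instance isIso_weakGamma : IsIso (weakGamma G M) := by
  have h : ∀ n, IsIso ((weakGamma G M).f n) := fun n => by
    rw [ConcreteCategory.isIso_iff_bijective]
    constructor
    · intro F F' h
      exact weakCochain_injective (congrArg Subtype.val h)
    · rintro ⟨φ, hφ⟩
      obtain ⟨F, hF⟩ := exists_weakCochain_eq hφ
      exact ⟨F, Subtype.ext hF⟩
  exact HomologicalComplex.Hom.isIso_of_components _

theorem projectionStar_weakGamma : projectionStar G M ≫ weakGamma G M = gammaComplex G M := by
  refine HomologicalComplex.hom_ext _ _ fun n => ?_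
  refine AddCommGrpCat.hom_ext (AddMonoidHom.ext
    fun f : (powerRep G (n + 1)).IntertwiningMap (Representation.ofDistribMulAction ℤ G M) =>
      Subtype.ext ?_)
  funext g
  exact congrArg f (projection_tupleProd _)

theorem isIso_gamma {i : ℕ} (hi : i ≤ 4) : IsIso (gamma G M i) := by
  have := isIso_homologyMap_projectionStar G M hi
  rw [gamma, ← projectionStar_weakGamma, HomologicalComplex.homologyMap_comp]
  infer_instance

end WeakCochains

end SymmetricCohomology

end

theorem mainTheorem4 {G : Type*} [Group G] {M : Type*} [AddCommGroup M] [DistribMulAction G M] :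
    (∀ i ≤ 4, CategoryTheory.Limits.IsZero (SymmetricCohomology.deltaCohomology G M i)) ∧
      ∀ i ≤ 4, CategoryTheory.IsIso (SymmetricCohomology.gamma G M i) :=
  ⟨fun _ hi => SymmetricCohomology.isZero_deltaCohomology G M hi,
    fun _ hi => SymmetricCohomology.isIso_gamma G M hi⟩
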